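/- **Setting.** Let $\mathcal S$ be a finite set of states with a metric $d$; let $\mathcal A(s)$ be a finite set of actions for each $s\in\mathcal S$, and $f(s,a)$ the (deterministic) successor state. Let $r:\mathcal S\to\mathbb R$ be a safety function, $h\in\mathbb R$ a threshold, $L\ge 0$, $\sigma>0$, $\epsilon>0$, $\delta\in(0,1)$, $B\geq 0$, and $k$ a positive semidefinite kernel on $\mathcal S$ with $k(s,s)\le 1$. For $X,Y\subseteq\mathcal S$ put - $R^{\mathrm{safe}}_\epsilon(X)=X\cup\{s:\exists s'\in X,\ r(s')-\epsilon-Ld(s,s')\ge h\}$, - $R^{\mathrm{reach}}(X)=X\cup\{s:\exists s'\in X,\,a\in\mathcal A(s'),\ s=f(s',a)\}$, - $R^{\mathrm{ret}}(Y,X)=X\cup\{s\in Y:\exists a\in\mathcal A(s),\ f(s,a)\in X\}$, and $\overline R^{\mathrm{ret}}(Y,X)$ the union (limit) of the iterates of $R^{\mathrm{ret}}(Y,\cdot)$ applied to $X$, - $R_\epsilon(X)=R^{\mathrm{safe}}_\epsilon(X)\cap R^{\mathrm{reach}}(X)\cap\overline R^{\mathrm{ret}}(R^{\mathrm{safe}}_\epsilon(X),X)$,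 and $\overline R_\epsilon(X)$ the union (limit) of the iterates of $R_\epsilon$ applied to $X$ (likewise with $0$ in place of $\epsilon$). Let $\gamma_t=\max_{a_1,\dots,a_t\in\mathcal S}\tfrac12\log\det\big(I+\sigma^{-2}(k(a_i,a_j))_{i,j}\big)$ be the maximal mutual information between a centered Gaussian process with covariance $k$ and $t$ observations of it (repetitions allowed) with $N(0,\sigma^2)$ noise, and $\beta_t=2B+300\,\gamma_t\log^3(t/\delta)$. **Algorithm (SafeMDP, run without a stopping rule).** Let $S_0\subseteq\mathcal S$ be the safe seed, $\hat S_0=S_0$, and $C_0(s)=[h,\infty)$ for $s\in S_0$, $C_0(s)=\mathbb R$ otherwise. The agent starts at a state $x_0\in S_0$. In iteration $t\ge1$, let $\mu_{t-1}(s)$ and $\sigma_{t-1}(s)$ be the posterior mean and standard deviation of the centered Gaussian process with kernel $k$ and noise variance $\sigma^2$ given the measurements $(x_1,y_1),\dots,(x_{t-1},y_{t-1})$; let $C_t(s)=C_{t-1}(s)\cap[\mu_{t-1}(s)\pm\beta_t^{1/2}\sigma_{t-1}(s)]$, with lower end $l_t(s)$ (the maximum of the lower ends of the intersected intervals), upper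 end $u_t(s)$ (the minimum of their upper ends) and $w_t=u_t-l_t$. Put $S_t=\{s:\exists s'\in\hat S_{t-1},\ l_t(s')-Ld(s,s')\ge h\}$, $\hat S_t=\{s\in S_t: s\in R^{\mathrm{reach}}(\hat S_{t-1})\cap\overline R^{\mathrm{ret}}(S_t,\hat S_{t-1})\}$ and $G_t=\{s\in\hat S_t:\exists s'\in\mathcal S\setminus S_t,\ u_t(s)-Ld(s,s')\ge h\}$. The agent chooses a target $x_t\in\operatorname{argmax}_{s\in G_t}w_t(s)$ if $G_t\ne\emptyset$, and an arbitrary $x_t\in\hat S_t$ if $G_t=\emptyset$; it travels from $x_{t-1}$ to $x_t$ along transitions of the MDP inside $S_t$ (possibly waiting in a state), and measures $y_t=r(x_t)+\omega_t$. **Theorem.** Assume that $r$ is $L$-Lipschitz with respect to $d$; that $r$ lies in the reproducing kernel Hilbert space of $k$ with $\|r\|_k^2\le B$; that, for a filtration $(\mathcal F_t)_{t\geq 0}$ (the history) such that $x_{t}$ is $\mathcal F_{t-1}$-measurable and $\omega_t$ is $\mathcal F_t$-measurable, the noise satisfies $\mathbb E[\omega_t\mid\mathcal F_{t-1}]=0$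 and $|\omega_t|\le\sigma$ almost surely for all $t\ge1$; and that $S_0\neq\emptyset$, $r\ge h$ on $S_0$, and $s'\in\overline R^{\mathrm{ret}}(S_0,\{s\})$ for all $s,s'\in S_0$. Let $(s_0,s_1,s_2,\dots)$ be the state trajectory of the agent (including all intermediate states). Then, with probability at least $1-\delta$, $r(s_n)\ge h$ for all $n\ge0$. Moreover, with $C=8/\log(1+\sigma^{-2})$, there is a smallest integer $t^*\ge|\overline R_0(S_0)|$ such that $$t^*\ \ge\ \frac{C\,|\overline R_0(S_0)|}{\epsilon^2}\,\beta_{t^*}\gamma_{t^*},$$ and there is a (deterministic) $t_0\le t^*$ such that, with probability at least $1-\delta$, $\overline R_\epsilon(S_0)\subseteq\hat S_{t_0}\subseteq\overline R_0(S_0)$. -/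

import Mathlib

open MeasureTheory
open scoped NNReal ENNReal Matrix

namespace SafeMDP

noncomputable section

/-- A finite Markov decision process with deterministic transitions (finiteness of the state space
`S` is imposed by `[Fintype S]` where it is used): `actions s` is the finite set of actions
available in the state `s`, and `next s a` is the state `f(s, a)`. -/
structure MDP (S A : Type*) where
  actions : S → Finset A
  next : S → A → S

namespace MDP

variable {S A : Type*} (M : MDP S A)

/-- `R^reach(X)`: `X` together with all states reachable from `X` in one step. -/
def reach (X : Set S) : Set S :=
  X ∪ {s | ∃ s' ∈ X, ∃ a ∈ M.actions s', s = M.next s' a}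

/-- `R^ret(Y, X)`: `X` together with all states of `Y` from which one step leads into `X`. -/
def ret (Y X : Set S) : Set S :=
  X ∪ {s | s ∈ Y ∧ ∃ a ∈ M.actions s, M.next s a ∈ X}

/-- The limit of the increasing sequence of sets `R^ret_n(Y, X)`, where `R^ret_n(Y, ·)` is the
`n`-fold iterate of `R^ret(Y, ·)`. -/
def retBar (Y X : Set S) : Set S :=
  ⋃ n : ℕ, (M.ret Y)^[n] X

variable [MetricSpace S]

/-- `R^safe_ε(X)`, for the safety function `r`, the Lipschitz constant `L` and the threshold `h`. -/
def safeExt (_M : MDP S A) (r : S → ℝ) (L : ℝ≥0) (h ε : ℝ) (X : Set S) : Set S :=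
  X ∪ {s | ∃ s' ∈ X, h ≤ r s' - ε - L * dist s s'}

/-- `R_ε(X) = R^safe_ε(X) ∩ R^reach(X) ∩ R̄^ret(R^safe_ε(X), X)`. -/
def expand (r : S → ℝ) (L : ℝ≥0) (h ε : ℝ) (X : Set S) : Set S :=
  M.safeExt r L h ε X ∩ M.reach X ∩ M.retBar (M.safeExt r L h ε X) X

/-- `R̄_ε(X)`, the limit of the increasing sequence of the `n`-fold iterates `R_ε^n(X)`. -/
def expandBar (r : S → ℝ) (L : ℝ≥0) (h ε : ℝ) (X : Set S) : Set S :=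
  ⋃ n : ℕ, (M.expand r L h ε)^[n] X

end MDP

/-- The inputs of the algorithm: the MDP, the Lipschitz constant `L`, the threshold `h`, the safe
seed `S₀`, the kernel `k`, the noise level `σ`, the bound `B` on the squared RKHS norm and the
failure probability `δ`. -/
structure Inputs (S A : Type*) where
  mdp : MDP S A
  L : ℝ≥0
  h : ℝ
  S₀ : Set S
  k : S → S → ℝ
  σ : ℝ
  B : ℝ
  δ : ℝ

namespace Inputs

variable {S A : Type*} (I : Inputs S A)

/-- The matrix `(k(a_i, a_j))_{i,j}` of a finite sequence of states. -/
def gram {t : ℕ} (a : Fin t → S) : Matrix (Fin t) (Fin t) ℝ :=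
  Matrix.of fun i j => I.k (a i) (a j)

/-- The mutual information `I(r; y_a) = (1/2) log det (1 + σ⁻² K_a)` between a centered Gaussian
process `r` with covariance `k` and its observations at `a_1, …, a_t` (repetitions allowed) with
independent `N(0, σ²)` noise. -/
def infoGain {t : ℕ} (a : Fin t → S) : ℝ :=
  (1 / 2) * Real.log (1 + (I.σ ^ 2)⁻¹ • I.gram a).det

/-- `γ_t`, the maximum mutual information obtainable from `t` noisy observations (a maximum over
finitely many sequences when `S` is finite). -/
def gamma (t : ℕ) : ℝ :=
  ⨆ a : Fin t → S, I.infoGain a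

/-- `β_t = 2 B + 300 γ_t log³(t / δ)`. -/
def beta (t : ℕ) : ℝ :=
  2 * I.B + 300 * I.gamma t * Real.log (t / I.δ) ^ 3

/- Below, `x 1, x 2, …` are the measured states and `y 1, y 2, …` the measured values; the entries
`x 0` (the initial state) and `y 0` are never used as data. -/

/-- The states of the first `t` measurements. -/
def design (x : ℕ → S) (t : ℕ) : Fin t → S := fun i => x (i + 1)

/-- The vector `(k(x_1, s), …, k(x_t, s))`. -/
def kvec (x : ℕ → S) (t : ℕ) (s : S) : Fin t → ℝ := fun i => I.k (x (i + 1)) s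

/-- The posterior mean `μ_t(s)` of the Gaussian process given the first `t` measurements. -/
def postMean (x : ℕ → S) (y : ℕ → ℝ) (t : ℕ) (s : S) : ℝ :=
  I.kvec x t s ⬝ᵥ
    ((I.gram (design x t) + I.σ ^ 2 • (1 : Matrix (Fin t) (Fin t) ℝ))⁻¹ *ᵥ
      fun i : Fin t => y (i + 1))

/-- The posterior standard deviation `σ_t(s)` given the first `t` measurements. -/
def postStd (x : ℕ → S) (t : ℕ) (s : S) : ℝ :=
  √(I.k s s - I.kvec x t s ⬝ᵥ
    ((I.gram (design x t) + I.σ ^ 2 • (1 : Matrix (Fin t) (Fin t) ℝ))⁻¹ *ᵥ I.kvec x t s))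

/- The confidence intervals are `C_0(s) = [h, ∞)` for `s ∈ S₀`, `C_0(s) = ℝ` for `s ∉ S₀`, and
`C_t(s) = C_{t-1}(s) ∩ [μ_{t-1}(s) - β_t^{1/2} σ_{t-1}(s), μ_{t-1}(s) + β_t^{1/2} σ_{t-1}(s)]`;
they are represented by their endpoints `l_t(s) = lower t s` and `u_t(s) = upper t s`. -/

open Classical in
/-- The lower end `l_t(s)` of `C_t(s)`. -/
def lower (x : ℕ → S) (y : ℕ → ℝ) : ℕ → S → EReal
  | 0, s => if s ∈ I.S₀ then (I.h : EReal) else ⊥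
  | t + 1, s => max (lower x y t s)
      ((I.postMean x y t s - √(I.beta (t + 1)) * I.postStd x t s : ℝ) : EReal)

/-- The upper end `u_t(s)` of `C_t(s)`. -/
def upper (x : ℕ → S) (y : ℕ → ℝ) : ℕ → S → EReal
  | 0, _ => ⊤
  | t + 1, s => min (upper x y t s)
      ((I.postMean x y t s + √(I.beta (t + 1)) * I.postStd x t s : ℝ) : EReal)

/-- `w_t(s) = u_t(s) - l_t(s)`. -/
def width (x : ℕ → S) (y : ℕ → ℝ) (t : ℕ) (s : S) : EReal :=
  I.upper x y t s - I.lower x y t s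

variable [MetricSpace S]

/-- The states `s` for which `l_t(s') - L d(s, s') ≥ h` for some `s' ∈ X`. -/
def certified (x : ℕ → S) (y : ℕ → ℝ) (t : ℕ) (X : Set S) : Set S :=
  {s | ∃ s' ∈ X, (I.h : EReal) ≤ I.lower x y t s' - ((I.L * dist s s' : ℝ) : EReal)}

/-- The sets `Ŝ_t`, with `Ŝ_0 = S₀`. -/
def hatS (x : ℕ → S) (y : ℕ → ℝ) : ℕ → Set S
  | 0 => I.S₀
  | t + 1 => {s | s ∈ I.certified x y (t + 1) (hatS x y t) ∧
      s ∈ I.mdp.reach (hatS x y t) ∧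
      s ∈ I.mdp.retBar (I.certified x y (t + 1) (hatS x y t)) (hatS x y t)}

/-- The sets `S_t`: the safe seed for `t = 0`, and the states certified as safe from `Ŝ_{t-1}` by
the bounds `l_t` for `t ≥ 1`. -/
def safeS (x : ℕ → S) (y : ℕ → ℝ) : ℕ → Set S
  | 0 => I.S₀
  | t + 1 => I.certified x y (t + 1) (I.hatS x y t)

/-- The enlargement function `g_t(s) = |{s' ∈ S ∖ S_t : u_t(s) - L d(s, s') ≥ h}|`. -/
def enlargement (x : ℕ → S) (y : ℕ → ℝ) (t : ℕ) (s : S) : ℕ :=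
  Set.ncard {s' | s' ∉ I.safeS x y t ∧
    (I.h : EReal) ≤ I.upper x y t s - ((I.L * dist s s' : ℝ) : EReal)}

/-- The set of potential expanders `G_t = {s ∈ Ŝ_t : g_t(s) > 0}`. -/
def expanders (x : ℕ → S) (y : ℕ → ℝ) (t : ℕ) : Set S :=
  {s | s ∈ I.hatS x y t ∧ 0 < I.enlargement x y t s}

/-- One (non-terminating) execution of the algorithm. In iteration `t ≥ 1` the sets `S_t`, `Ŝ_t`
and `G_t` are computed from the earlier measurements, a target state `x t` is chosen, the agent
travels to it inside `S_t`, and the value `y t` is measured there. The state of the agent at time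
`n` is `path n`, and iteration `t` ends at time `τ t`; the agent may wait in a state. -/
structure IsExecution (x : ℕ → S) (y : ℕ → ℝ) (τ : ℕ → ℕ) (path : ℕ → S) : Prop where
  /-- The agent starts in the safe seed. -/
  init_mem : x 0 ∈ I.S₀
  /-- Target states belong to `Ŝ_t`; this is the only requirement when `G_t` is empty. -/
  target_mem : ∀ t, 1 ≤ t → x t ∈ I.hatS x y t
  /-- If `G_t` is nonempty, the target state maximizes `w_t` over `G_t`. -/
  target_argmax : ∀ t, 1 ≤ t → (I.expanders x y t).Nonempty →
    x t ∈ I.expanders x y t ∧ ∀ s ∈ I.expanders x y t, I.width x y t s ≤ I.width x y t (x t)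
  time_zero : τ 0 = 0
  time_strictMono : StrictMono τ
  /-- Every step of the agent is a transition of the MDP, unless the agent waits. -/
  step : ∀ n, path (n + 1) = path n ∨
    ∃ a ∈ I.mdp.actions (path n), path (n + 1) = I.mdp.next (path n) a
  /-- At the end of iteration `t` the agent is in the target state `x t`. -/
  arrive : ∀ t, path (τ t) = x t
  /-- During iteration `t + 1` the agent travels inside `S_{t+1}`. -/
  travel : ∀ t n, τ t ≤ n → n ≤ τ (t + 1) → path n ∈ I.safeS x y (t + 1)

end Inputs

/-- The property `Q` holds with probability at least `q`: there is a measurable event of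
probability at least `q` on which it holds. -/
def HoldsWithProb {Ω : Type*} [MeasurableSpace Ω] (P : Measure Ω) (q : ℝ) (Q : Ω → Prop) : Prop :=
  ∃ E : Set Ω, MeasurableSet E ∧ ENNReal.ofReal q ≤ P E ∧ ∀ ω ∈ E, Q ω

end

end SafeMDP

/-! The proof separates a probabilistic half from a deterministic one. On a single event of
probability at least `1 - δ`, `r s` lies within `√β_{t+1} σ_t(s)` of `μ_t(s)` for all `t` and `s`
(`holdsWithProb_confidence`). On that event safety and completeness are deterministic facts about
the execution.

Confidence. On a finite state space the RKHS becomes Euclidean: `k` is a Gram matrix of feature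
vectors and `r` is linear with coefficient vector `θ`, `|θ|² ≤ B` (`exists_features`). The posterior
is then ridge regression with `V = σ² + ∑ z zᵀ`, and its error is at most `√B` plus the `V⁻¹`-norm
of the noise sum, times `σ_t(s)`. For noise in `[-1, 1]`, `selfNorm` is dominated at each step by a
factor affine in the new noise, so its expectation is at most one. Markov at each fixed time and a
union bound over times give a bound of the form `log det + log (1/δ)`. The second term is not
proportional to `γ`, whereas the noise part of `β` is. `invQuad_le_of_logVol_le` repairs this by
passing to the regularization `min 1 (4γ) σ²`, which turns the bound into `γ (1 + log (1/δ))` up to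
constants.

Exploration. The sets `Ŝ_t` increase and stay inside `R̄_0(S₀)`, so at most `|R̄_0(S₀)| - 1`
iterations change them. If an iteration changes nothing although `R_ε` still enlarges `Ŝ_t`, the
measured state has width above `ε` (`lt_postStd_of_hatS_eq`). The sum of the posterior variances at
measured states is bounded by the information gain (`sum_postStd_sq_le`), so there cannot be too
many such iterations. Counting over all of `0, …, T - 1` at once gives the contradiction in
`expandBar_subset_hatS`. Finally `t*` exists because `β_t γ_t` is polylogarithmic in `t`. -/

namespace SafeMDP

noncomputable section

set_option linter.unusedSectionVars false

/-! ### Linear algebra of rank-one updates of a regularized Gram matrix. -/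

section RegularizedGram

variable {ι : Type*} [Fintype ι] [DecidableEq ι]

/-- The regularized second moment matrix `λ + ∑_{i < t} z_i z_iᵀ`. -/
def regMat (lam : ℝ) (z : ℕ → ι → ℝ) (t : ℕ) : Matrix ι ι ℝ :=
  lam • 1 + ∑ i ∈ Finset.range t, Matrix.vecMulVec (z i) (z i)

/-- The squared norm of `u` with respect to the inverse of `regMat`. -/
def invQuad (lam : ℝ) (z : ℕ → ι → ℝ) (t : ℕ) (u : ι → ℝ) : ℝ :=
  u ⬝ᵥ ((regMat lam z t)⁻¹ *ᵥ u)

/-- The logarithm of the determinant of `regMat`, up to normalization. -/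
def logVol (lam : ℝ) (z : ℕ → ι → ℝ) (t : ℕ) : ℝ :=
  ∑ i ∈ Finset.range t, Real.log (1 + invQuad lam z i (z i))

/-- The sum `∑_{i < t} n_i z_i`. -/
def noiseSum (z : ℕ → ι → ℝ) (n : ℕ → ℝ) (t : ℕ) : ι → ℝ :=
  ∑ i ∈ Finset.range t, n i • z i

variable {lam : ℝ} (hlam : 0 < lam) (z : ℕ → ι → ℝ) (t : ℕ)

lemma regMat_succ : regMat lam z (t + 1) = regMat lam z t + Matrix.vecMulVec (z t) (z t) := by
  simp [regMat, Finset.sum_range_succ, add_assoc]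

lemma noiseSum_succ (n : ℕ → ℝ) : noiseSum z n (t + 1) = noiseSum z n t + n t • z t := by
  simp [noiseSum, Finset.sum_range_succ]

lemma logVol_succ :
    logVol lam z (t + 1) = logVol lam z t + Real.log (1 + invQuad lam z t (z t)) := by
  simp [logVol, Finset.sum_range_succ]

include hlam in
lemma regMat_posDef : (regMat lam z t).PosDef := by
  induction t with
  | zero => simpa [regMat] using (Matrix.PosDef.one (n := ι) (R := ℝ)).smul hlam
  | succ t ih =>
    rw [regMat_succ]
    refine ih.add_posSemidef ?_
    simpa using Matrix.posSemidef_vecMulVec_self_star (z t)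

include hlam in
lemma regMat_isUnit_det : IsUnit (regMat lam z t).det :=
  (regMat_posDef hlam z t).det_pos.ne'.isUnit

lemma regMat_transpose : (regMat lam z t)ᵀ = regMat lam z t := by
  simp [regMat, Matrix.transpose_sum, Matrix.transpose_vecMulVec]

lemma regMat_inv_transpose : ((regMat lam z t)⁻¹)ᵀ = (regMat lam z t)⁻¹ := by
  rw [Matrix.transpose_nonsing_inv, regMat_transpose]

/-- The inverse of `regMat` is symmetric. -/
lemma dotProduct_inv_comm (u w : ι → ℝ) :
    u ⬝ᵥ ((regMat lam z t)⁻¹ *ᵥ w) = w ⬝ᵥ ((regMat lam z t)⁻¹ *ᵥ u) := by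
  rw [Matrix.dotProduct_mulVec, ← Matrix.mulVec_transpose, regMat_inv_transpose, dotProduct_comm]

include hlam in
lemma regMat_mulVec_inv (u : ι → ℝ) : regMat lam z t *ᵥ ((regMat lam z t)⁻¹ *ᵥ u) = u := by
  rw [Matrix.mulVec_mulVec, Matrix.mul_nonsing_inv _ (regMat_isUnit_det hlam z t),
    Matrix.one_mulVec]

include hlam in
lemma inv_mulVec_regMat (u : ι → ℝ) : (regMat lam z t)⁻¹ *ᵥ (regMat lam z t *ᵥ u) = u := by
  rw [Matrix.mulVec_mulVec, Matrix.nonsing_inv_mul _ (regMat_isUnit_det hlam z t),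
    Matrix.one_mulVec]

lemma dotProduct_regMat (u w : ι → ℝ) : u ⬝ᵥ (regMat lam z t *ᵥ w) =
    lam * (u ⬝ᵥ w) + ∑ i ∈ Finset.range t, (z i ⬝ᵥ u) * (z i ⬝ᵥ w) := by
  induction t with
  | zero => simp [regMat, Matrix.smul_mulVec]
  | succ t ih =>
    rw [regMat_succ, Matrix.add_mulVec, dotProduct_add, ih, Finset.sum_range_succ,
      Matrix.vecMulVec_mulVec, dotProduct_smul]
    simp [dotProduct_comm u (z t)]
    ring

lemma dotProduct_self_nonneg' (u : ι → ℝ) : 0 ≤ u ⬝ᵥ u :=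
  Finset.sum_nonneg fun _ _ => mul_self_nonneg _

lemma dotProduct_sq_le (u w : ι → ℝ) : (u ⬝ᵥ w) ^ 2 ≤ (u ⬝ᵥ u) * (w ⬝ᵥ w) := by
  simpa [dotProduct, sq] using Finset.sum_mul_sq_le_sq_mul_sq Finset.univ u w

open scoped MatrixOrder in
/-- The Cauchy-Schwarz inequality for a positive semidefinite matrix. -/
lemma dotProduct_mulVec_sq_le {W : Matrix ι ι ℝ} (hW : W.PosSemidef) (u w : ι → ℝ) :
    (u ⬝ᵥ (W *ᵥ w)) ^ 2 ≤ (u ⬝ᵥ (W *ᵥ u)) * (w ⬝ᵥ (W *ᵥ w)) := by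
  obtain ⟨B, rfl⟩ := CStarAlgebra.nonneg_iff_eq_star_mul_self.mp hW.nonneg
  rw [Matrix.star_eq_conjTranspose]
  have key : ∀ a b : ι → ℝ, a ⬝ᵥ ((Bᴴ * B) *ᵥ b) = (B *ᵥ a) ⬝ᵥ (B *ᵥ b) := by
    intro a b
    rw [← Matrix.mulVec_mulVec, Matrix.dotProduct_mulVec,
      Matrix.conjTranspose_eq_transpose_of_trivial, Matrix.vecMul_transpose]
  simp only [key]
  exact dotProduct_sq_le _ _

include hlam in
lemma regMat_inv_posSemidef : ((regMat lam z t)⁻¹).PosSemidef :=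
  (regMat_posDef hlam z t).inv.posSemidef

include hlam in
lemma invQuad_nonneg (u : ι → ℝ) : 0 ≤ invQuad lam z t u := by
  simpa [invQuad] using (regMat_inv_posSemidef hlam z t).dotProduct_mulVec_nonneg u

include hlam in
lemma dotProduct_inv_sq_le (u w : ι → ℝ) : (u ⬝ᵥ ((regMat lam z t)⁻¹ *ᵥ w)) ^ 2 ≤
    invQuad lam z t u * invQuad lam z t w :=
  dotProduct_mulVec_sq_le (regMat_inv_posSemidef hlam z t) u w

include hlam in
lemma mul_invQuad_le (u : ι → ℝ) : lam * invQuad lam z t u ≤ u ⬝ᵥ u := by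
  set w := (regMat lam z t)⁻¹ *ᵥ u with hw
  have h1 : invQuad lam z t u = w ⬝ᵥ (regMat lam z t *ᵥ w) := by
    rw [hw, regMat_mulVec_inv hlam, dotProduct_comm]; rfl
  have h2 : lam * (w ⬝ᵥ w) ≤ invQuad lam z t u := by
    rw [h1, dotProduct_regMat]
    have := Finset.sum_nonneg fun i (_ : i ∈ Finset.range t) => mul_self_nonneg (z i ⬝ᵥ w)
    linarith
  have h3 : (invQuad lam z t u) ^ 2 ≤ (u ⬝ᵥ u) * (w ⬝ᵥ w) := dotProduct_sq_le u w
  have h4 := invQuad_nonneg hlam z t u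
  have h5 := dotProduct_self_nonneg' u
  rcases h4.eq_or_lt with h | h
  · rw [← h]; simpa using h5
  · have : invQuad lam z t u * (lam * invQuad lam z t u) ≤ invQuad lam z t u * (u ⬝ᵥ u) := by
      nlinarith
    exact le_of_mul_le_mul_left this h

include hlam in
-- No eigenvalue of `regMat` exceeds `lam` plus the trace of the rank-one terms; Cauchy-Schwarz
-- transfers this to the inverse.
lemma le_mul_invQuad (u : ι → ℝ) :
    u ⬝ᵥ u ≤ (lam + ∑ i ∈ Finset.range t, z i ⬝ᵥ z i) * invQuad lam z t u := by
  have h0 := dotProduct_self_nonneg' u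
  have h1 : (u ⬝ᵥ u) ^ 2 ≤ (u ⬝ᵥ (regMat lam z t *ᵥ u)) * invQuad lam z t u := by
    have h := dotProduct_mulVec_sq_le (regMat_posDef hlam z t).posSemidef u
      ((regMat lam z t)⁻¹ *ᵥ u)
    rw [regMat_mulVec_inv hlam, dotProduct_comm ((regMat lam z t)⁻¹ *ᵥ u)] at h
    exact h
  have h2 : u ⬝ᵥ (regMat lam z t *ᵥ u) ≤
      (lam + ∑ i ∈ Finset.range t, z i ⬝ᵥ z i) * (u ⬝ᵥ u) := by
    rw [dotProduct_regMat, add_mul, Finset.sum_mul]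
    refine add_le_add_right (Finset.sum_le_sum fun i _ => ?_) _
    rw [← sq]
    exact dotProduct_sq_le _ _
  have h3 := invQuad_nonneg hlam z t u
  rcases h0.eq_or_lt with h | h
  · rw [← h]
    exact mul_nonneg (add_nonneg hlam.le
      (Finset.sum_nonneg fun i _ => dotProduct_self_nonneg' (z i))) h3
  · have := mul_le_mul_of_nonneg_right h2 h3
    nlinarith

include hlam in
/-- The Sherman-Morrison formula. -/
lemma inv_regMat_succ : (regMat lam z (t + 1))⁻¹ = (regMat lam z t)⁻¹ -
    (1 + invQuad lam z t (z t))⁻¹ • Matrix.vecMulVec ((regMat lam z t)⁻¹ *ᵥ z t)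
      ((regMat lam z t)⁻¹ *ᵥ z t) := by
  have hv := invQuad_nonneg hlam z t (z t)
  apply Matrix.inv_eq_right_inv
  have e : Matrix.vecMulVec (z t) (z t) * (regMat lam z t)⁻¹ =
      Matrix.vecMulVec (z t) ((regMat lam z t)⁻¹ *ᵥ z t) := by
    rw [Matrix.vecMulVec_mul, ← Matrix.mulVec_transpose, regMat_inv_transpose]
  rw [regMat_succ, add_mul, mul_sub, mul_sub, Matrix.mul_nonsing_inv _ (regMat_isUnit_det hlam z t),
    e, Matrix.mul_smul, Matrix.mul_smul, Matrix.mul_vecMulVec, regMat_mulVec_inv hlam,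
    Matrix.mul_vecMulVec, Matrix.vecMulVec_mulVec]
  change 1 - _ + (_ - _ • Matrix.vecMulVec (MulOpposite.op (invQuad lam z t (z t)) • z t) _) = _
  rw [op_smul_eq_smul, Matrix.smul_vecMulVec, smul_smul]
  have : (1 + invQuad lam z t (z t))⁻¹ * invQuad lam z t (z t) =
    1 - (1 + invQuad lam z t (z t))⁻¹ := by field_simp; ring
  rw [this, sub_smul, one_smul]
  abel

include hlam in
-- Sherman-Morrison separates the new noise `n t` from quantities fixed earlier; this increment is
-- the exponent treated in `exp_step_le`.
lemma invQuad_succ (n : ℕ → ℝ) :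
    invQuad lam z (t + 1) (noiseSum z n (t + 1)) = invQuad lam z t (noiseSum z n t) +
      (-(z t ⬝ᵥ ((regMat lam z t)⁻¹ *ᵥ noiseSum z n t)) ^ 2 +
        2 * n t * (z t ⬝ᵥ ((regMat lam z t)⁻¹ *ᵥ noiseSum z n t)) +
        n t ^ 2 * invQuad lam z t (z t)) / (1 + invQuad lam z t (z t)) := by
  have hv := invQuad_nonneg hlam z t (z t)
  have h1 : invQuad lam z (t + 1) (noiseSum z n (t + 1)) =
      invQuad lam z t (noiseSum z n (t + 1)) -
      (1 + invQuad lam z t (z t))⁻¹ *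
        (z t ⬝ᵥ ((regMat lam z t)⁻¹ *ᵥ noiseSum z n (t + 1))) ^ 2 := by
    rw [invQuad, inv_regMat_succ hlam, Matrix.sub_mulVec, dotProduct_sub, Matrix.smul_mulVec,
      dotProduct_smul, Matrix.vecMulVec_mulVec, op_smul_eq_smul, dotProduct_smul,
      dotProduct_inv_comm z t (noiseSum z n (t + 1)) (z t),
      dotProduct_comm ((regMat lam z t)⁻¹ *ᵥ z t),
      dotProduct_inv_comm z t (noiseSum z n (t + 1)) (z t), sq]
    rfl
  have h2 : z t ⬝ᵥ ((regMat lam z t)⁻¹ *ᵥ noiseSum z n (t + 1)) =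
      z t ⬝ᵥ ((regMat lam z t)⁻¹ *ᵥ noiseSum z n t) + n t * invQuad lam z t (z t) := by
    rw [noiseSum_succ, Matrix.mulVec_add, dotProduct_add, Matrix.mulVec_smul, dotProduct_smul]
    rfl
  have h3 : invQuad lam z t (noiseSum z n (t + 1)) = invQuad lam z t (noiseSum z n t) +
      2 * n t * (z t ⬝ᵥ ((regMat lam z t)⁻¹ *ᵥ noiseSum z n t)) +
        n t ^ 2 * invQuad lam z t (z t) := by
    rw [invQuad, noiseSum_succ, Matrix.mulVec_add, dotProduct_add, add_dotProduct, add_dotProduct,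
      Matrix.mulVec_smul, dotProduct_smul, dotProduct_smul, smul_dotProduct, smul_dotProduct,
      dotProduct_inv_comm z t (noiseSum z n t) (z t)]
    simp only [invQuad, smul_eq_mul]
    ring
  rw [h1, h2, h3]
  field_simp
  ring

include hlam in
-- By the matrix determinant lemma, each rank-one update multiplies the determinant by `1 + invQuad
-- lam z t (z t)`.
lemma det_regMat : (regMat lam z t).det = lam ^ Fintype.card ι * Real.exp (logVol lam z t) := by
  induction t with
  | zero => simp [regMat, logVol]
  | succ t ih =>
    have hv := invQuad_nonneg hlam z t (z t)
    have e : regMat lam z (t + 1) = regMat lam z t *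
        (1 + Matrix.vecMulVec ((regMat lam z t)⁻¹ *ᵥ z t) (z t)) := by
      rw [regMat_succ, mul_add, mul_one, Matrix.mul_vecMulVec, regMat_mulVec_inv hlam]
    rw [e, Matrix.det_mul, ih, logVol_succ, Real.exp_add, Real.exp_log (by linarith),
      Matrix.vecMulVec_eq Unit, Matrix.det_one_add_replicateCol_mul_replicateRow, invQuad]
    ring

include hlam in
lemma logVol_mono : Monotone (logVol lam z) := by
  refine monotone_nat_of_le_succ fun t => ?_
  rw [logVol_succ]
  have := Real.log_nonneg (show 1 ≤ 1 + invQuad lam z t (z t) by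
    linarith [invQuad_nonneg hlam z t (z t)])
  linarith

include hlam in
lemma logVol_nonneg : 0 ≤ logVol lam z t := by
  have := logVol_mono hlam z (Nat.zero_le t)
  simpa [logVol] using this

include hlam in
lemma logVol_le : lam * logVol lam z t ≤ ∑ i ∈ Finset.range t, z i ⬝ᵥ z i := by
  rw [logVol, Finset.mul_sum]
  refine Finset.sum_le_sum fun i _ => ?_
  refine le_trans ?_ (mul_invQuad_le hlam z i (z i))
  have := Real.log_le_sub_one_of_pos (show 0 < 1 + invQuad lam z i (z i) by
    linarith [invQuad_nonneg hlam z i (z i)])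
  gcongr
  linarith

include hlam in
-- One step multiplies the right side by `1 + v`, and `le_mul_invQuad` bounds the new squared norm
-- by `v` times the current left side. Thus a small log-volume forces small feature vectors.
lemma le_exp_logVol :
    lam + ∑ i ∈ Finset.range t, z i ⬝ᵥ z i ≤ lam * Real.exp (logVol lam z t) := by
  induction t with
  | zero => simp [logVol]
  | succ t ih =>
    have hv := invQuad_nonneg hlam z t (z t)
    have h1 := le_mul_invQuad hlam z t (z t)
    rw [logVol_succ, Real.exp_add, Real.exp_log (by linarith), Finset.sum_range_succ]
    nlinarith

end RegularizedGram

/-! ### The Gaussian process posterior as ridge regression in feature space. -/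

section Posterior

variable {S A ι : Type*} [Fintype ι] [DecidableEq ι] (I : Inputs S A)
  {feat : S → ι → ℝ} (hfeat : ∀ s s', I.k s s' = feat s ⬝ᵥ feat s') (hσ : 0 < I.σ) (x : ℕ → S)

/-- The matrix with rows `z_0, …, z_{t-1}`. -/
def designMat (z : ℕ → ι → ℝ) (t : ℕ) : Matrix (Fin t) ι ℝ := Matrix.of fun i => z i

lemma regMat_eq_designMat (lam : ℝ) (z : ℕ → ι → ℝ) (t : ℕ) :
    regMat lam z t = lam • 1 + (designMat z t)ᵀ * designMat z t := by
  rw [regMat]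
  congr 1
  ext a b
  rw [Matrix.sum_apply, Matrix.mul_apply, ← Fin.sum_univ_eq_sum_range
    (fun i => Matrix.vecMulVec (z i) (z i) a b)]
  rfl

lemma designMat_transpose_mulVec (z : ℕ → ι → ℝ) (y : ℕ → ℝ) (t : ℕ) :
    (designMat z t)ᵀ *ᵥ (fun i : Fin t => y i) = noiseSum z y t := by
  ext a
  rw [noiseSum, Finset.sum_apply, ← Fin.sum_univ_eq_sum_range (fun i => (y i • z i) a)]
  simp [Matrix.mulVec, dotProduct, designMat, mul_comm]

include hfeat in
lemma gram_eq_designMat (t : ℕ) : I.gram (Inputs.design x t) =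
    designMat (fun i => feat (x (i + 1))) t * (designMat (fun i => feat (x (i + 1))) t)ᵀ := by
  ext i j
  simp [Inputs.gram, Inputs.design, hfeat, Matrix.mul_apply, designMat, dotProduct]

include hfeat in
lemma kvec_eq_designMat (t : ℕ) (s : S) :
    I.kvec x t s = designMat (fun i => feat (x (i + 1))) t *ᵥ feat s := by
  ext i
  simp [Inputs.kvec, hfeat, designMat, Matrix.mulVec]

/-- The push-through identity, which exchanges the `t × t` kernel matrix for the matrix on feature
space. -/
lemma designMat_transpose_mul_inv {lam : ℝ} (hlam : 0 < lam) (z : ℕ → ι → ℝ) (t : ℕ) :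
    (designMat z t)ᵀ * (designMat z t * (designMat z t)ᵀ + lam • 1)⁻¹ =
      (regMat lam z t)⁻¹ * (designMat z t)ᵀ := by
  have hG : IsUnit (designMat z t * (designMat z t)ᵀ + lam • (1 : Matrix (Fin t) (Fin t) ℝ)).det := by
    refine IsUnit.mk0 _ (Matrix.PosDef.det_pos ?_).ne'
    have h := Matrix.posSemidef_self_mul_conjTranspose (designMat z t)
    rw [Matrix.conjTranspose_eq_transpose_of_trivial] at h
    exact ((Matrix.PosDef.one (n := Fin t) (R := ℝ)).smul hlam).posSemidef_add h
  have hV := regMat_isUnit_det hlam z t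
  have e : regMat lam z t * (designMat z t)ᵀ =
      (designMat z t)ᵀ * (designMat z t * (designMat z t)ᵀ + lam • 1) := by
    rw [regMat_eq_designMat, Matrix.add_mul, Matrix.mul_add, Matrix.mul_assoc, add_comm]
    simp
  calc _ = (regMat lam z t)⁻¹ * (regMat lam z t * (designMat z t)ᵀ) *
        (designMat z t * (designMat z t)ᵀ + lam • 1)⁻¹ := by
        rw [← Matrix.mul_assoc, Matrix.nonsing_inv_mul _ hV, Matrix.one_mul]
    _ = _ := by
        rw [e, Matrix.mul_assoc, Matrix.mul_assoc, Matrix.mul_nonsing_inv _ hG, Matrix.mul_one]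

include hfeat hσ in
lemma postMean_eq (y : ℕ → ℝ) (t : ℕ) (s : S) : I.postMean x y t s =
    feat s ⬝ᵥ ((regMat (I.σ ^ 2) (fun i => feat (x (i + 1))) t)⁻¹ *ᵥ
      noiseSum (fun i => feat (x (i + 1))) (fun i => y (i + 1)) t) := by
  rw [Inputs.postMean, kvec_eq_designMat I hfeat, gram_eq_designMat I hfeat,
    ← Matrix.vecMul_transpose, ← Matrix.dotProduct_mulVec, Matrix.mulVec_mulVec,
    designMat_transpose_mul_inv (by positivity), ← Matrix.mulVec_mulVec,
    designMat_transpose_mulVec _ (fun i => y (i + 1))]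

include hfeat hσ in
lemma postStd_eq (t : ℕ) (s : S) : I.postStd x t s =
    √(I.σ ^ 2 * invQuad (I.σ ^ 2) (fun i => feat (x (i + 1))) t (feat s)) := by
  have hlam : 0 < I.σ ^ 2 := by positivity
  rw [Inputs.postStd, kvec_eq_designMat I hfeat, gram_eq_designMat I hfeat]
  congr 1
  set z : ℕ → ι → ℝ := fun i => feat (x (i + 1))
  nth_rewrite 1 [← Matrix.vecMul_transpose]
  rw [← Matrix.dotProduct_mulVec, Matrix.mulVec_mulVec,
    designMat_transpose_mul_inv hlam, Matrix.mulVec_mulVec, Matrix.mul_assoc]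
  have e : (designMat z t)ᵀ * designMat z t = regMat (I.σ ^ 2) z t - (I.σ ^ 2) • 1 := by
    rw [regMat_eq_designMat]; abel
  rw [e, mul_sub, Matrix.nonsing_inv_mul _ (regMat_isUnit_det hlam z t), Matrix.sub_mulVec,
    dotProduct_sub, Matrix.one_mulVec, hfeat, Matrix.mul_smul, Matrix.mul_one, Matrix.smul_mulVec,
    dotProduct_smul]
  simp [invQuad]

include hfeat hσ in
lemma infoGain_design_eq (t : ℕ) : I.infoGain (Inputs.design x t) =
    1 / 2 * logVol (I.σ ^ 2) (fun i => feat (x (i + 1))) t := by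
  have hlam : 0 < I.σ ^ 2 := by positivity
  rw [Inputs.infoGain, gram_eq_designMat I hfeat]
  set z : ℕ → ι → ℝ := fun i => feat (x (i + 1))
  rw [← Matrix.smul_mul, Matrix.det_one_add_mul_comm]
  have e : 1 + (designMat z t)ᵀ * (I.σ ^ 2)⁻¹ • designMat z t =
      (I.σ ^ 2)⁻¹ • regMat (I.σ ^ 2) z t := by
    rw [regMat_eq_designMat, smul_add, smul_smul, inv_mul_cancel₀ hlam.ne', one_smul,
      Matrix.mul_smul]
  rw [e, Matrix.det_smul, det_regMat hlam, ← mul_assoc, ← mul_pow, inv_mul_cancel₀ hlam.ne',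
    one_pow, one_mul, Real.log_exp]

end Posterior

/-! ### Reduction of the RKHS to finite-dimensional features. -/

section Features

/-- In finitely many points, an RKHS is described by feature vectors in a Euclidean space. -/
lemma exists_features {S H : Type*} [Fintype S] [NormedAddCommGroup H] [InnerProductSpace ℝ H]
    [CompleteSpace H] [RKHS ℝ H S ℝ] (k : S → S → ℝ)
    (hk : ∀ s s', RKHS.kernel H s s' 1 = k s s') (g : H) :
    ∃ (d : ℕ) (feat : S → Fin d → ℝ) (θ : Fin d → ℝ),
      (∀ s s', k s s' = feat s ⬝ᵥ feat s') ∧ (∀ s, g s = θ ⬝ᵥ feat s) ∧ θ ⬝ᵥ θ ≤ ‖g‖ ^ 2 := by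
  -- Evaluations see only the projection of `g` onto the span of the kernel functions, and by
  -- Bessel's inequality the projection has no larger norm.
  let W : Submodule ℝ H := Submodule.span ℝ (Set.range fun s => RKHS.kerFun H s (1 : ℝ))
  have : FiniteDimensional ℝ W := FiniteDimensional.span_of_finite ℝ (Set.finite_range _)
  let b := stdOrthonormalBasis ℝ W
  have hb : Orthonormal ℝ fun i => (b i : H) := b.orthonormal.comp_linearIsometry W.subtypeₗᵢ
  let κ : S → W := fun s => ⟨RKHS.kerFun H s (1 : ℝ), Submodule.subset_span ⟨s, rfl⟩⟩
  refine ⟨_, fun s i => inner ℝ (b i) (κ s), fun i => inner ℝ (b i : H) g, fun s s' => ?_,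
    fun s => ?_, ?_⟩
  · have h1 : k s s' = inner ℝ (κ s) (κ s') := by
      rw [Submodule.coe_inner]
      simp only [κ]
      rw [RKHS.kerFun_inner, RKHS.kerFun_apply, hk]
      simp
    rw [h1, ← b.sum_inner_mul_inner, dotProduct]
    exact Finset.sum_congr rfl fun i _ => by rw [real_inner_comm]
  · have h1 : g s = inner ℝ (κ s : H) g := by
      simp only [κ]
      rw [RKHS.kerFun_inner]
      simp
    rw [h1]
    conv_lhs => rw [← b.sum_repr (κ s)]
    simp only [Submodule.coe_sum, Submodule.coe_smul, sum_inner, real_inner_smul_left, dotProduct,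
      b.repr_apply_apply]
    exact Finset.sum_congr rfl fun i _ => mul_comm _ _
  · have := hb.sum_inner_products_le g (s := Finset.univ)
    simpa [dotProduct, sq] using this

end Features

/-! ### The self-normalized exponential process and its tail bound. -/

section Supermartingale

variable {ι : Type*} [Fintype ι] [DecidableEq ι]

/-- The self-normalized process associated with `noiseSum`. -/
def selfNorm (lam : ℝ) (z : ℕ → ι → ℝ) (n : ℕ → ℝ) (t : ℕ) : ℝ :=
  Real.exp ((invQuad lam z t (noiseSum z n t) - logVol lam z t) / 2)

/-- The coefficient of the new noise in the bound for one step of `selfNorm`. -/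
def stepSlope (v m : ℝ) : ℝ :=
  Real.exp ((v - m ^ 2) / (1 + v) / 2 - Real.log (1 + v) / 2) * Real.sinh (m / (1 + v))

/-- Using `cosh a ≤ exp (a² / 2)`, the total exponent is nonpositive because `log (1 + v) ≥ v / (1 +
v)`. -/
lemma step_mul_cosh_le_one {v : ℝ} (hv : 0 ≤ v) (m : ℝ) :
    Real.exp ((v - m ^ 2) / (1 + v) / 2 - Real.log (1 + v) / 2) * Real.cosh (m / (1 + v)) ≤ 1 := by
  have hv1 : 0 < 1 + v := by linarith
  refine (mul_le_mul_of_nonneg_left (Real.cosh_le_exp_half_sq _) (Real.exp_pos _).le).trans ?_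
  rw [← Real.exp_add, Real.exp_le_one_iff]
  have h1 : v / (1 + v) ≤ Real.log (1 + v) := by
    have := Real.one_sub_inv_le_log_of_pos hv1
    have e : v / (1 + v) = 1 - (1 + v)⁻¹ := by field_simp; ring
    rwa [e]
  have h2 : (v - m ^ 2) / (1 + v) + (m / (1 + v)) ^ 2 = v / (1 + v) - v * m ^ 2 / (1 + v) ^ 2 := by
    field_simp
    ring
  have h3 : 0 ≤ v * m ^ 2 / (1 + v) ^ 2 := by positivity
  linarith

lemma abs_stepSlope_le_one {v : ℝ} (hv : 0 ≤ v) (m : ℝ) : |stepSlope v m| ≤ 1 := by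
  refine le_trans ?_ (step_mul_cosh_le_one hv m)
  rw [stepSlope, abs_mul, Real.abs_exp, Real.abs_sinh]
  gcongr
  rw [← Real.cosh_abs]
  exact (Real.sinh_lt_cosh _).le

/-- Replace `n²` by `1`, then use convexity of `exp` on `[-1, 1]` to bound by a function affine in
`n`. Conditionally centered noise then contributes nothing to the expectation. -/
lemma exp_step_le {v : ℝ} (hv : 0 ≤ v) (m : ℝ) {n : ℝ} (hn : |n| ≤ 1) :
    Real.exp ((-m ^ 2 + 2 * n * m + n ^ 2 * v) / (1 + v) / 2 - Real.log (1 + v) / 2) ≤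
      1 + stepSlope v m * n := by
  have hv1 : 0 < 1 + v := by linarith
  have hn2 : n ^ 2 ≤ 1 := (sq_le_one_iff_abs_le_one n).mpr hn
  have h1 : (-m ^ 2 + 2 * n * m + n ^ 2 * v) / (1 + v) / 2 - Real.log (1 + v) / 2 ≤
      ((v - m ^ 2) / (1 + v) / 2 - Real.log (1 + v) / 2) + n * (m / (1 + v)) := by
    have : (-m ^ 2 + 2 * n * m + n ^ 2 * v) / (1 + v) ≤ (v - m ^ 2 + 2 * n * m) / (1 + v) := by
      exact div_le_div_of_nonneg_right (by nlinarith) hv1.le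
    have e : (v - m ^ 2 + 2 * n * m) / (1 + v) =
      (v - m ^ 2) / (1 + v) + 2 * (n * (m / (1 + v))) := by ring
    linarith
  refine (Real.exp_le_exp.mpr h1).trans ?_
  rw [Real.exp_add]
  have h2 := mul_le_mul_of_nonneg_left (Real.exp_mul_le_cosh_add_mul_sinh hn (m / (1 + v)))
    (Real.exp_pos ((v - m ^ 2) / (1 + v) / 2 - Real.log (1 + v) / 2)).le
  have h3 := step_mul_cosh_le_one hv m
  rw [stepSlope]
  linarith

lemma selfNorm_succ_le {lam : ℝ} (hlam : 0 < lam) (z : ℕ → ι → ℝ) (n : ℕ → ℝ) (t : ℕ)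
    (hn : |n t| ≤ 1) : selfNorm lam z n (t + 1) ≤ selfNorm lam z n t *
      (1 + stepSlope (invQuad lam z t (z t))
        (z t ⬝ᵥ ((regMat lam z t)⁻¹ *ᵥ noiseSum z n t)) * n t) := by
  rw [selfNorm, invQuad_succ hlam, logVol_succ]
  set v := invQuad lam z t (z t)
  set m := z t ⬝ᵥ ((regMat lam z t)⁻¹ *ᵥ noiseSum z n t)
  have h := exp_step_le (invQuad_nonneg hlam z t (z t)) m hn
  have := mul_le_mul_of_nonneg_left h
    (Real.exp_pos ((invQuad lam z t (noiseSum z n t) - logVol lam z t) / 2)).le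
  rw [← Real.exp_add] at this
  rw [selfNorm]
  refine (Real.exp_le_exp.mpr (le_of_eq ?_)).trans this
  ring

variable {Ω : Type*} {m : MeasurableSpace Ω} {lam : ℝ} (hlam : 0 < lam)
  {Z : ℕ → Ω → ι → ℝ} {N : ℕ → Ω → ℝ}

lemma measurable_noiseSum (t : ℕ) (hZ : ∀ i < t, ∀ j, Measurable fun ω => Z i ω j)
    (hN : ∀ i < t, Measurable (N i)) (j : ι) :
    Measurable fun ω => noiseSum (fun i => Z i ω) (fun i => N i ω) t j := by
  simp only [noiseSum, Finset.sum_apply, Pi.smul_apply, smul_eq_mul]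
  exact Finset.measurable_sum _ fun i hi =>
    (hN i (Finset.mem_range.mp hi)).mul (hZ i (Finset.mem_range.mp hi) j)

lemma measurable_stepSlope {v w : Ω → ℝ} (hv : Measurable v) (hw : Measurable w) :
    Measurable fun ω => stepSlope (v ω) (w ω) := by
  unfold stepSlope
  fun_prop

lemma measurable_dotProduct {u w : Ω → ι → ℝ} (hu : ∀ j, Measurable fun ω => u ω j)
    (hw : ∀ j, Measurable fun ω => w ω j) : Measurable fun ω => u ω ⬝ᵥ w ω :=
  Finset.measurable_sum _ fun j _ => (hu j).mul (hw j)

include hlam in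
-- Sherman-Morrison builds the inverse recursively from measurable operations.
lemma measurable_inv_regMat (t : ℕ) (hZ : ∀ i < t, ∀ j, Measurable fun ω => Z i ω j) (j j' : ι) :
    Measurable fun ω => (regMat lam (fun i => Z i ω) t)⁻¹ j j' := by
  induction t generalizing j j' with
  | zero => simp [regMat]
  | succ t ih =>
    have ih' := ih fun i hi => hZ i (hi.trans (Nat.lt_succ_self t))
    have hz := hZ t (Nat.lt_succ_self t)
    have hw : ∀ j, Measurable fun ω => ((regMat lam (fun i => Z i ω) t)⁻¹ *ᵥ Z t ω) j :=
      fun j => measurable_dotProduct (ih' j) hz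
    simp only [inv_regMat_succ hlam, invQuad, Matrix.sub_apply, Matrix.smul_apply,
      Matrix.vecMulVec_apply, smul_eq_mul]
    exact (ih' j j').sub ((((measurable_dotProduct hz hw).const_add 1).inv).mul
      ((hw j).mul (hw j')))

include hlam in
lemma measurable_inv_dotProduct (t : ℕ) (hZ : ∀ i < t, ∀ j, Measurable fun ω => Z i ω j)
    {u w : Ω → ι → ℝ} (hu : ∀ j, Measurable fun ω => u ω j)
    (hw : ∀ j, Measurable fun ω => w ω j) :
    Measurable fun ω => u ω ⬝ᵥ ((regMat lam (fun i => Z i ω) t)⁻¹ *ᵥ w ω) :=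
  measurable_dotProduct hu fun j => measurable_dotProduct (measurable_inv_regMat hlam t hZ j) hw

include hlam in
lemma measurable_selfNorm (t : ℕ) (hZ : ∀ i < t, ∀ j, Measurable fun ω => Z i ω j)
    (hN : ∀ i < t, Measurable (N i)) :
    Measurable fun ω => selfNorm lam (fun i => Z i ω) (fun i => N i ω) t := by
  have hS := measurable_noiseSum t hZ hN
  refine Real.measurable_exp.comp (((measurable_inv_dotProduct hlam t hZ hS hS).sub ?_).div_const 2)
  refine Finset.measurable_sum _ fun i hi => Real.measurable_log.comp (Measurable.const_add ?_ 1)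
  rw [Finset.mem_range] at hi
  exact measurable_inv_dotProduct hlam i (fun i' hi' => hZ i' (hi'.trans hi)) (hZ i hi) (hZ i hi)

include hlam in
/-- The self-normalized process has expectation at most one. -/
lemma integral_selfNorm_le_one {mΩ : MeasurableSpace Ω} (P : Measure Ω) [IsProbabilityMeasure P]
    (ℱ : Filtration ℕ mΩ) (hZ : ∀ t j, Measurable[ℱ t] fun ω => Z t ω j)
    (hN : ∀ t, Measurable[ℱ (t + 1)] (N t)) (hN0 : ∀ t, P[N t | ℱ t] =ᵐ[P] 0)
    (hN1 : ∀ t, ∀ᵐ ω ∂P, |N t ω| ≤ 1) (t : ℕ) :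
    Integrable (fun ω => selfNorm lam (fun i => Z i ω) (fun i => N i ω) t) P ∧
      ∫ ω, selfNorm lam (fun i => Z i ω) (fun i => N i ω) t ∂P ≤ 1 := by
  have hZ' : ∀ {t i : ℕ}, i ≤ t → ∀ j, Measurable[ℱ t] fun ω => Z i ω j :=
    fun h j => (hZ _ j).mono (ℱ.mono h) le_rfl
  have hN' : ∀ {t i : ℕ}, i < t → Measurable[ℱ t] (N i) :=
    fun h => (hN _).mono (ℱ.mono h) le_rfl
  have hM : ∀ t, Measurable[ℱ t] fun ω => selfNorm lam (fun i => Z i ω) (fun i => N i ω) t :=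
    fun t => measurable_selfNorm hlam t (fun i hi => hZ' hi.le) fun i hi => hN' hi
  induction t with
  | zero => simp [selfNorm, noiseSum, logVol, invQuad]
  | succ t ih =>
    obtain ⟨ihi, ih1⟩ := ih
    set M : Ω → ℝ := fun ω => selfNorm lam (fun i => Z i ω) (fun i => N i ω) t with hMdef
    set b : Ω → ℝ := fun ω => stepSlope (invQuad lam (fun i => Z i ω) t (Z t ω))
      (Z t ω ⬝ᵥ ((regMat lam (fun i => Z i ω) t)⁻¹ *ᵥ
        noiseSum (fun i => Z i ω) (fun i => N i ω) t)) with hbdef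
    have hb1 : ∀ ω, |b ω| ≤ 1 := fun ω => abs_stepSlope_le_one (invQuad_nonneg hlam _ _ _) _
    have hv : Measurable[ℱ t] fun ω => invQuad lam (fun i => Z i ω) t (Z t ω) :=
      measurable_inv_dotProduct (m := ℱ t) hlam t (fun i hi => hZ' hi.le) (hZ t) (hZ t)
    have hm : Measurable[ℱ t] fun ω => Z t ω ⬝ᵥ ((regMat lam (fun i => Z i ω) t)⁻¹ *ᵥ
        noiseSum (fun i => Z i ω) (fun i => N i ω) t) :=
      measurable_inv_dotProduct (m := ℱ t) hlam t (fun i hi => hZ' hi.le) (hZ t)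
        (measurable_noiseSum (m := ℱ t) t (fun i hi => hZ' hi.le) fun i hi => hN' hi)
    have hb : Measurable[ℱ t] b := measurable_stepSlope (m := ℱ t) hv hm
    have hMpos : ∀ ω, 0 < M ω := fun ω => Real.exp_pos _
    have hle : ∀ᵐ ω ∂P, selfNorm lam (fun i => Z i ω) (fun i => N i ω) (t + 1) ≤
        M ω + M ω * b ω * N t ω := by
      filter_upwards [hN1 t] with ω hω
      refine (selfNorm_succ_le hlam _ _ t hω).trans_eq ?_
      simp only [hMdef, hbdef]
      ring
    have hNmeas : Measurable (N t) := (hN t).mono (ℱ.le _) le_rfl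
    have hNi : Integrable (N t) P :=
      Integrable.of_bound hNmeas.aestronglyMeasurable 1 (by simpa using hN1 t)
    have hMb : Measurable[ℱ t] fun ω => M ω * b ω := (hM t).mul hb
    have hMbN : Integrable (fun ω => M ω * b ω * N t ω) P := by
      refine ihi.mono' ((hMb.mono (ℱ.le _) le_rfl).mul hNmeas).aestronglyMeasurable ?_
      filter_upwards [hN1 t] with ω hω
      rw [Real.norm_eq_abs, abs_mul, abs_mul, abs_of_pos (hMpos ω), mul_assoc]
      exact mul_le_of_le_one_right (hMpos ω).le (mul_le_one₀ (hb1 ω) (abs_nonneg _) hω)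
    -- The coefficient `M * b` is known at time `t`, so it comes out of the conditional expectation
    -- of `N t`, which vanishes.
    have hint0 : ∫ ω, M ω * b ω * N t ω ∂P = 0 := by
      have h1 := condExp_mul_of_stronglyMeasurable_left (μ := P) (m := ℱ t)
        (f := fun ω => M ω * b ω) (g := N t) hMb.stronglyMeasurable hMbN hNi
      have h2 : ∫ ω, M ω * b ω * N t ω ∂P = ∫ ω, (P[(fun ω => M ω * b ω) * N t | ℱ t]) ω ∂P :=
        (integral_condExp (ℱ.le t)).symm
      rw [h2, integral_congr_ae h1]
      refine integral_eq_zero_of_ae ?_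
      filter_upwards [hN0 t] with ω hω
      simp [hω]
    have hi : Integrable (fun ω => selfNorm lam (fun i => Z i ω) (fun i => N i ω) (t + 1)) P := by
      refine (ihi.add hMbN).mono' ((hM (t + 1)).mono (ℱ.le _) le_rfl).aestronglyMeasurable ?_
      filter_upwards [hle] with ω hω
      rw [selfNorm, Real.norm_eq_abs, Real.abs_exp]
      exact hω
    refine ⟨hi, ?_⟩
    calc _ ≤ ∫ ω, (M ω + M ω * b ω * N t ω) ∂P := integral_mono_ae hi (ihi.add hMbN) hle
      _ = ∫ ω, M ω ∂P := by rw [integral_add ihi hMbN, hint0, add_zero]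
      _ ≤ 1 := ih1

include hlam in
/-- A self-normalized tail bound at a fixed time. -/
lemma measure_invQuad_noiseSum_gt {mΩ : MeasurableSpace Ω} (P : Measure Ω)
    [IsProbabilityMeasure P]
    (ℱ : Filtration ℕ mΩ) (hZ : ∀ t j, Measurable[ℱ t] fun ω => Z t ω j)
    (hN : ∀ t, Measurable[ℱ (t + 1)] (N t)) (hN0 : ∀ t, P[N t | ℱ t] =ᵐ[P] 0)
    (hN1 : ∀ t, ∀ᵐ ω ∂P, |N t ω| ≤ 1) (t : ℕ) {δ : ℝ} (hδ : 0 < δ) :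
    P {ω | logVol lam (fun i => Z i ω) t + 2 * Real.log (1 / δ) <
      invQuad lam (fun i => Z i ω) t (noiseSum (fun i => Z i ω) (fun i => N i ω) t)} ≤
      ENNReal.ofReal δ := by
  obtain ⟨hi, h1⟩ := integral_selfNorm_le_one hlam P ℱ hZ hN hN0 hN1 t
  have hmarkov := mul_meas_ge_le_integral_of_nonneg (μ := P)
    (f := fun ω => selfNorm lam (fun i => Z i ω) (fun i => N i ω) t)
    (Filter.Eventually.of_forall fun ω => (Real.exp_pos _).le) hi (1 / δ)
  have h2 : P.real {ω | 1 / δ ≤ selfNorm lam (fun i => Z i ω) (fun i => N i ω) t} ≤ δ := by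
    have := hmarkov.trans h1
    rwa [one_div_mul_eq_div, div_le_iff₀ hδ, one_mul] at this
  refine (measure_mono fun ω hω => ?_).trans
    ((ENNReal.le_ofReal_iff_toReal_le (measure_ne_top _ _) hδ.le).mpr h2)
  simp only [Set.mem_ofPred_eq] at hω ⊢
  rw [selfNorm, ← Real.log_le_iff_le_exp (by positivity)]
  linarith

end Supermartingale

/-! ### Monotonicity of the information gain and of `β`. -/

section InformationGain

variable {S A ι : Type*} [Finite S] [Fintype ι] [DecidableEq ι] (I : Inputs S A)
  {feat : S → ι → ℝ} (hfeat : ∀ s s', I.k s s' = feat s ⬝ᵥ feat s') (hσ : 0 < I.σ)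

lemma infoGain_le_gamma {t : ℕ} (a : Fin t → S) : I.infoGain a ≤ I.gamma t :=
  le_ciSup (f := fun a : Fin t → S => I.infoGain a) (Set.finite_range _).bddAbove a

include hfeat hσ in
lemma logVol_le_two_mul_gamma (x : ℕ → S) (t : ℕ) :
    logVol (I.σ ^ 2) (fun i => feat (x (i + 1))) t ≤ 2 * I.gamma t := by
  have := infoGain_le_gamma I (Inputs.design x t)
  rw [infoGain_design_eq I hfeat hσ] at this
  linarith

lemma exists_eq_design [Nonempty S] {t : ℕ} (a : Fin t → S) :
    ∃ x : ℕ → S, a = Inputs.design x t := by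
  classical
  -- The shift reflects that measurements are numbered from `1`; values outside `1, …, t` are never
  -- read.
  refine ⟨fun i => if h : i - 1 < t then a ⟨i - 1, h⟩ else Classical.arbitrary S, ?_⟩
  ext i
  simp [Inputs.design]

include hfeat hσ in
lemma gamma_mono [Nonempty S] : Monotone I.gamma := by
  refine monotone_nat_of_le_succ fun t => ciSup_le fun a => ?_
  obtain ⟨x, rfl⟩ := exists_eq_design a
  have h1 := logVol_le_two_mul_gamma I hfeat hσ x (t + 1)
  have h2 := logVol_mono (pow_pos hσ 2) (fun i => feat (x (i + 1))) (Nat.le_succ t)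
  rw [infoGain_design_eq I hfeat hσ]
  linarith

include hfeat hσ in
lemma gamma_nonneg [Nonempty S] (t : ℕ) : 0 ≤ I.gamma t := by
  have h1 := logVol_le_two_mul_gamma I hfeat hσ (fun _ => Classical.arbitrary S) t
  have h2 := logVol_nonneg (pow_pos hσ 2) (fun _ => feat (Classical.arbitrary S)) t
  linarith

include hfeat hσ in
lemma beta_mono [Nonempty S] (hδ0 : 0 < I.δ) (hδ1 : I.δ < 1) {s t : ℕ} (hs : 1 ≤ s)
    (hst : s ≤ t) : I.beta s ≤ I.beta t := by
  have hs1 : (1 : ℝ) ≤ s := by exact_mod_cast hs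
  have h1 : 0 ≤ Real.log (s / I.δ) := Real.log_nonneg ((one_le_div hδ0).mpr (by linarith))
  have h2 : Real.log (s / I.δ) ≤ Real.log (t / I.δ) := by
    gcongr
  have h3 := gamma_nonneg I hfeat hσ s
  have h4 := gamma_mono I hfeat hσ hst
  have h5 : 0 ≤ I.gamma t := h3.trans h4
  unfold Inputs.beta
  gcongr

end InformationGain

/-! ### From the tail bound to confidence intervals valid at all times. -/

section Confidence

variable {ι : Type*} [Fintype ι] [DecidableEq ι]

lemma exp_le_one_add_two_mul {x : ℝ} (h0 : 0 ≤ x) (h1 : x ≤ 1 / 2) : Real.exp x ≤ 1 + 2 * x := by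
  have h2 := Real.one_sub_le_exp_neg x
  rw [Real.exp_neg] at h2
  have h3 := Real.exp_pos x
  have h4 : (1 - x) * Real.exp x ≤ 1 := by
    have := mul_le_mul_of_nonneg_right h2 h3.le
    rwa [inv_mul_cancel₀ h3.ne'] at this
  have h5 : (1 - x) * Real.exp x ≤ (1 - x) * (1 + 2 * x) := by nlinarith
  exact le_of_mul_le_mul_left h5 (by linarith)

/-- Comparison of the regularization `λ` with the smaller one `min 1 (4 γ) λ`, which is
adapted to the information gain. -/
lemma invQuad_le_of_logVol_le {lam γ : ℝ} (hlam : 0 < lam) (hγ : 0 < γ) (z : ℕ → ι → ℝ) (t : ℕ)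
    (h : logVol lam z t ≤ 2 * γ) (u : ι → ℝ) :
    invQuad lam z t u ≤ 2 * min 1 (4 * γ) * invQuad (min 1 (4 * γ) * lam) z t u ∧
      min 1 (4 * γ) * logVol (min 1 (4 * γ) * lam) z t ≤ 4 * γ := by
  rcases le_total 1 (4 * γ) with h1 | h1
  · rw [min_eq_left h1, one_mul]
    have := invQuad_nonneg hlam z t u
    constructor <;> linarith
  · rw [min_eq_right h1]
    have hc : 0 < 4 * γ * lam := by positivity
    -- Since `exp (2γ) ≤ 1 + 4γ`, the trace is at most the new regularization `4γ lam`. The new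
    -- matrix is therefore at most `8γ lam`, whence the factor `2` in the comparison.
    have htr : ∑ i ∈ Finset.range t, z i ⬝ᵥ z i ≤ 4 * γ * lam := by
      have h2 := le_exp_logVol hlam z t
      have h3 := (Real.exp_le_exp.mpr h).trans
        (exp_le_one_add_two_mul (by positivity) (by linarith))
      nlinarith
    constructor
    · have h2 := mul_invQuad_le hlam z t u
      have h3 := le_mul_invQuad hc z t u
      have h4 := invQuad_nonneg hc z t u
      have h5 : lam * invQuad lam z t u ≤
          lam * (2 * (4 * γ) * invQuad (4 * γ * lam) z t u) := by nlinarith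
      exact le_of_mul_le_mul_left h5 hlam
    · have h2 := (logVol_le hc z t).trans htr
      have h3 : logVol (4 * γ * lam) z t ≤ 1 := by
        nlinarith
      nlinarith

/-- Covers `γ = 0`, where the adapted regularization degenerates: all measured features vanish. -/
lemma noiseSum_eq_zero {lam : ℝ} (hlam : 0 < lam) (z : ℕ → ι → ℝ) (n : ℕ → ℝ) (t : ℕ)
    (h : logVol lam z t ≤ 0) : noiseSum z n t = 0 := by
  have h1 := le_exp_logVol hlam z t
  have h2 : ∑ i ∈ Finset.range t, z i ⬝ᵥ z i ≤ 0 := by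
    have := Real.exp_le_one_iff.mpr h
    nlinarith
  have h3 := (Finset.sum_eq_zero_iff_of_nonneg fun i _ => dotProduct_self_nonneg' (z i)).mp
    (h2.antisymm (Finset.sum_nonneg fun i _ => dotProduct_self_nonneg' (z i)))
  exact Finset.sum_eq_zero fun i hi => by
    rw [dotProduct_self_eq_zero.mp (h3 i hi), smul_zero]

lemma noiseSum_linear (z : ℕ → ι → ℝ) (θ : ι → ℝ) (n : ℕ → ℝ) (lam c : ℝ) (t : ℕ) :
    noiseSum z (fun i => θ ⬝ᵥ z i + c * n i) t =
      regMat lam z t *ᵥ θ - lam • θ + c • noiseSum z n t := by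
  induction t with
  | zero => simp [noiseSum, regMat, Matrix.smul_mulVec]
  | succ t ih =>
    rw [noiseSum_succ, ih, regMat_succ, noiseSum_succ, Matrix.add_mulVec, Matrix.vecMulVec_mulVec,
      op_smul_eq_smul, dotProduct_comm (z t), add_smul, smul_add, mul_smul]
    abel

/-- The error of the posterior mean. -/
lemma abs_sub_postMean_le {S A : Type*} (I : Inputs S A)
    {feat : S → ι → ℝ} (hfeat : ∀ s s', I.k s s' = feat s ⬝ᵥ feat s') (hσ : 0 < I.σ)
    {θ : ι → ℝ} {r : S → ℝ} (hr : ∀ s, r s = θ ⬝ᵥ feat s) (hθ : θ ⬝ᵥ θ ≤ I.B)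
    (x : ℕ → S) (n : ℕ → ℝ) (t : ℕ) (s : S) :
    |r s - I.postMean x (fun i => r (x i) + n i) t s| ≤ (√I.B +
      √(invQuad (I.σ ^ 2) (fun i => feat (x (i + 1))) t
        (noiseSum (fun i => feat (x (i + 1))) (fun i => n (i + 1) / I.σ) t))) *
      I.postStd x t s := by
  have hlam : 0 < I.σ ^ 2 := by positivity
  rw [postMean_eq I hfeat hσ, postStd_eq I hfeat hσ]
  set z : ℕ → ι → ℝ := fun i => feat (x (i + 1)) with hz
  have e : noiseSum z (fun i => r (x (i + 1)) + n (i + 1)) t =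
      regMat (I.σ ^ 2) z t *ᵥ θ - (I.σ ^ 2) • θ +
        I.σ • noiseSum z (fun i => n (i + 1) / I.σ) t := by
    rw [← noiseSum_linear]
    congr 1
    ext i
    rw [hr, mul_div_cancel₀ _ hσ.ne']
  rw [e, Matrix.mulVec_add, Matrix.mulVec_sub, inv_mulVec_regMat hlam, Matrix.mulVec_smul,
    Matrix.mulVec_smul, dotProduct_add, dotProduct_sub, dotProduct_smul, dotProduct_smul, hr,
    dotProduct_comm θ]
  set S' := noiseSum z (fun i => n (i + 1) / I.σ) t
  set q := invQuad (I.σ ^ 2) z t (feat s)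
  have hq : 0 ≤ q := invQuad_nonneg hlam z t _
  have h1 : |feat s ⬝ᵥ ((regMat (I.σ ^ 2) z t)⁻¹ *ᵥ θ)| ≤
      √q * √(invQuad (I.σ ^ 2) z t θ) := by
    rw [← Real.sqrt_mul hq]
    exact Real.abs_le_sqrt (dotProduct_inv_sq_le hlam z t _ _)
  have h2 : |feat s ⬝ᵥ ((regMat (I.σ ^ 2) z t)⁻¹ *ᵥ S')| ≤
      √q * √(invQuad (I.σ ^ 2) z t S') := by
    rw [← Real.sqrt_mul hq]
    exact Real.abs_le_sqrt (dotProduct_inv_sq_le hlam z t _ _)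
  have h3 : I.σ * √(invQuad (I.σ ^ 2) z t θ) ≤ √I.B := by
    have : √(I.σ ^ 2 * invQuad (I.σ ^ 2) z t θ) ≤ √I.B :=
      Real.sqrt_le_sqrt ((mul_invQuad_le hlam z t θ).trans hθ)
    rwa [Real.sqrt_mul hlam.le, Real.sqrt_sq hσ.le] at this
  rw [Real.sqrt_mul hlam.le, Real.sqrt_sq hσ.le]
  -- The error splits into a regularization bias and a noise term, each bounded by Cauchy-Schwarz
  -- for `V⁻¹`.
  have h4 : feat s ⬝ᵥ θ - (feat s ⬝ᵥ θ - I.σ ^ 2 • (feat s ⬝ᵥ ((regMat (I.σ ^ 2) z t)⁻¹ *ᵥ θ)) +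
      I.σ • (feat s ⬝ᵥ ((regMat (I.σ ^ 2) z t)⁻¹ *ᵥ S'))) =
      I.σ ^ 2 * (feat s ⬝ᵥ ((regMat (I.σ ^ 2) z t)⁻¹ *ᵥ θ)) -
        I.σ * (feat s ⬝ᵥ ((regMat (I.σ ^ 2) z t)⁻¹ *ᵥ S')) := by
    simp only [smul_eq_mul]
    ring
  rw [h4]
  refine (abs_sub _ _).trans ?_
  rw [abs_mul, abs_mul, abs_of_pos hσ, abs_of_pos hlam, add_mul]
  refine add_le_add ?_ ?_
  · calc _ ≤ I.σ ^ 2 * (√q * √(invQuad (I.σ ^ 2) z t θ)) := by gcongr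
      _ = (I.σ * √(invQuad (I.σ ^ 2) z t θ)) * (I.σ * √q) := by ring
      _ ≤ _ := by gcongr
  · calc _ ≤ I.σ * (√q * √(invQuad (I.σ ^ 2) z t S')) := by gcongr
      _ = _ := by ring

/-- The numerical comparison of the self-normalized bound with `β`. -/
lemma sqrt_add_sqrt_le_sqrt_beta {B γ Z δ : ℝ} (hB : 0 ≤ B) (hγ : 0 ≤ γ) (hδ0 : 0 < δ)
    (hδ1 : δ < 1) (t : ℕ) (hZ0 : 0 ≤ Z)
    (hZ : Z ≤ 8 * γ * (1 + 2 * Real.log (1 / (δ / ((t + 1) * (t + 2)))))) :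
    √B + √Z ≤ √(2 * B + 300 * γ * Real.log (((t + 1 + 1 : ℕ) : ℝ) / δ) ^ 3) := by
  set ℓ := Real.log (((t + 1 + 1 : ℕ) : ℝ) / δ)
  have ht : (0 : ℝ) ≤ t := t.cast_nonneg
  have hℓ : 0.69 ≤ ℓ := by
    have h1 : Real.log 2 ≤ ℓ := by
      refine Real.log_le_log two_pos ?_
      rw [le_div_iff₀ hδ0]
      push_cast
      nlinarith
    linarith [Real.log_two_gt_d9]
  have hlog : Real.log (1 / (δ / ((t + 1) * (t + 2)))) ≤ 2 * ℓ := by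
    have e : 2 * ℓ = Real.log ((((t + 1 + 1 : ℕ) : ℝ) / δ) ^ 2) := by
      rw [Real.log_pow]; norm_num [ℓ]
    rw [e]
    refine Real.log_le_log (by positivity) ?_
    rw [one_div_div, div_pow, div_le_div_iff₀ hδ0 (by positivity)]
    push_cast
    have h1 : ((t : ℝ) + 1) * (t + 2) ≤ (t + 1 + 1) ^ 2 := by nlinarith
    have h2 : δ ^ 2 ≤ δ := by nlinarith
    exact mul_le_mul h1 h2 (by positivity) (by positivity)
  -- Here `ℓ ≥ log 2 > 0.69`, so the cube dominates the linear term.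
  have hpoly : 16 * (1 + 4 * ℓ) ≤ 300 * ℓ ^ 3 := by
    nlinarith [mul_nonneg (sub_nonneg.mpr hℓ) (sub_nonneg.mpr hℓ),
      mul_nonneg (mul_nonneg (sub_nonneg.mpr hℓ) (sub_nonneg.mpr hℓ)) (sub_nonneg.mpr hℓ)]
  refine Real.le_sqrt_of_sq_le ?_
  have h1 : (√B + √Z) ^ 2 ≤ 2 * B + 2 * Z := by
    have := sq_nonneg (√B - √Z)
    nlinarith [Real.sq_sqrt hB, Real.sq_sqrt hZ0]
  have h2 : 2 * Z ≤ γ * (16 * (1 + 4 * ℓ)) := by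
    have : 8 * γ * (1 + 2 * Real.log (1 / (δ / ((t + 1) * (t + 2))))) ≤
        8 * γ * (1 + 2 * (2 * ℓ)) := by gcongr
    linarith
  have h3 : γ * (16 * (1 + 4 * ℓ)) ≤ γ * (300 * ℓ ^ 3) := by gcongr
  linarith

lemma sum_div_le (δ : ℝ) (hδ : 0 ≤ δ) (n : ℕ) :
    ∑ j ∈ Finset.range n, δ / (((j : ℝ) + 1) * (j + 2)) ≤ δ := by
  have : ∑ j ∈ Finset.range n, δ / (((j : ℝ) + 1) * (j + 2)) = δ - δ / (n + 1) := by
    induction n with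
    | zero => simp
    | succ n ih =>
      rw [Finset.sum_range_succ, ih]
      push_cast
      field_simp
      ring
  rw [this]
  have : 0 ≤ δ / ((n : ℝ) + 1) := by positivity
  linarith

/-- The bad event need not be measurable; it is replaced by a measurable hull of the same measure.
-/
lemma holdsWithProb_compl {Ω : Type*} [MeasurableSpace Ω] (P : Measure Ω) [IsProbabilityMeasure P]
    {δ : ℝ} (hδ : 0 ≤ δ) {s : Set Ω} (hs : P s ≤ ENNReal.ofReal δ) :
    HoldsWithProb P (1 - δ) fun ω => ω ∉ s := by
  refine ⟨(toMeasurable P s)ᶜ, (measurableSet_toMeasurable P s).compl, ?_,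
    fun ω hω h => hω (subset_toMeasurable P s h)⟩
  rw [prob_compl_eq_one_sub (measurableSet_toMeasurable P s), measure_toMeasurable,
    ENNReal.ofReal_sub _ hδ, ENNReal.ofReal_one]
  exact tsub_le_tsub_left hs 1

lemma HoldsWithProb.mono {Ω : Type*} [MeasurableSpace Ω] {P : Measure Ω} {q : ℝ}
    {Q Q' : Ω → Prop} (h : HoldsWithProb P q Q) (hQ : ∀ ω, Q ω → Q' ω) : HoldsWithProb P q Q' :=
  let ⟨E, hE, hq, hEQ⟩ := h
  ⟨E, hE, hq, fun ω hω => hQ ω (hEQ ω hω)⟩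

/-- The confidence intervals hold simultaneously at all times with high probability. -/
theorem holdsWithProb_confidence {S A Ω : Type*} [Finite S] [Nonempty S] {mΩ : MeasurableSpace Ω}
    (P : Measure Ω) [IsProbabilityMeasure P] (I : Inputs S A) (r : S → ℝ)
    (hσ : 0 < I.σ) (hδ0 : 0 < I.δ) (hδ1 : I.δ < 1)
    {feat : S → ι → ℝ} (hfeat : ∀ s s', I.k s s' = feat s ⬝ᵥ feat s')
    {θ : ι → ℝ} (hr : ∀ s, r s = θ ⬝ᵥ feat s) (hθ : θ ⬝ᵥ θ ≤ I.B)
    (ℱ : Filtration ℕ mΩ) (noise : ℕ → Ω → ℝ)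
    (hnoise_meas : ∀ t, StronglyMeasurable[ℱ (t + 1)] (noise (t + 1)))
    (hnoise_mean : ∀ t, P[noise (t + 1) | ℱ t] =ᵐ[P] 0)
    (hnoise_bdd : ∀ t, ∀ᵐ ω ∂P, |noise (t + 1) ω| ≤ I.σ)
    (x : ℕ → Ω → S) (hx_meas : ∀ t s, MeasurableSet[ℱ t] {ω | x (t + 1) ω = s}) :
    HoldsWithProb P (1 - I.δ) fun ω => ∀ t s,
      |r s - I.postMean (fun t => x t ω) (fun t => r (x t ω) + noise t ω) t s| ≤
        √(I.beta (t + 1)) * I.postStd (fun t => x t ω) t s := by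
  have hlam : 0 < I.σ ^ 2 := by positivity
  have hB : 0 ≤ I.B := (dotProduct_self_nonneg' θ).trans hθ
  let Z : ℕ → Ω → ι → ℝ := fun i ω => feat (x (i + 1) ω)
  let N : ℕ → Ω → ℝ := fun i ω => noise (i + 1) ω / I.σ
  -- Index `j` stands for `j + 1` measurements, whose interval uses `β_{j+2}`. The regularization
  -- built from `γ j` is deterministic, as the tail bound requires.
  let γ : ℕ → ℝ := fun j => I.gamma (j + 2)
  have hγ : ∀ j, 0 ≤ γ j := fun j => gamma_nonneg I hfeat hσ _
  let δ' : ℕ → ℝ := fun j => I.δ / (((j : ℝ) + 1) * (j + 2))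
  have hδ' : ∀ j, 0 < δ' j := fun j => by positivity
  let bad : ℕ → Set Ω := fun j => {ω | 0 < γ j ∧
    logVol (min 1 (4 * γ j) * I.σ ^ 2) (fun i => Z i ω) (j + 1) + 2 * Real.log (1 / δ' j) <
      invQuad (min 1 (4 * γ j) * I.σ ^ 2) (fun i => Z i ω) (j + 1)
        (noiseSum (fun i => Z i ω) (fun i => N i ω) (j + 1))}
  have hZ : ∀ t j, Measurable[ℱ t] fun ω => Z t ω j := by
    intro t j
    let _ : MeasurableSpace S := ⊤
    have hx : Measurable[ℱ t] (x (t + 1)) := @measurable_to_countable' S Ω _ _ (ℱ t) _ (hx_meas t)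
    exact (measurable_from_top (f := fun s => feat s j)).comp hx
  have hN : ∀ t, Measurable[ℱ (t + 1)] (N t) := fun t =>
    (hnoise_meas t).measurable.div_const I.σ
  have hN0 : ∀ t, P[N t | ℱ t] =ᵐ[P] 0 := by
    intro t
    have e : N t = I.σ⁻¹ • noise (t + 1) := by
      ext ω
      simp [N, div_eq_inv_mul]
    rw [e]
    refine (condExp_smul _ _ _).trans ?_
    filter_upwards [hnoise_mean t] with ω hω
    simp [hω]
  have hN1 : ∀ t, ∀ᵐ ω ∂P, |N t ω| ≤ 1 := by
    intro t
    filter_upwards [hnoise_bdd t] with ω hω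
    rw [abs_div, abs_of_pos hσ]
    exact (div_le_one hσ).mpr hω
  have hbad : ∀ j, P (bad j) ≤ ENNReal.ofReal (δ' j) := by
    intro j
    rcases (hγ j).eq_or_lt with h | h
    · have : bad j = ∅ := Set.eq_empty_of_forall_notMem fun ω hω => hω.1.ne h
      simp [this]
    · have hc : 0 < min 1 (4 * γ j) * I.σ ^ 2 := by positivity
      exact (measure_mono fun ω hω => hω.2).trans
        (measure_invQuad_noiseSum_gt hc P ℱ hZ hN hN0 hN1 (j + 1) (hδ' j))
  have hunion : P (⋃ j, bad j) ≤ ENNReal.ofReal I.δ := by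
    refine (measure_iUnion_le _).trans ((ENNReal.tsum_le_tsum hbad).trans ?_)
    refine ENNReal.tsum_le_of_sum_range_le fun n => ?_
    rw [← ENNReal.ofReal_sum_of_nonneg fun j _ => (hδ' j).le]
    exact ENNReal.ofReal_le_ofReal (sum_div_le I.δ hδ0.le n)
  refine (holdsWithProb_compl P hδ0.le hunion).mono fun ω hω t s => ?_
  refine (abs_sub_postMean_le I hfeat hσ hr hθ (fun t => x t ω) (fun t => noise t ω) t s).trans ?_
  refine mul_le_mul_of_nonneg_right ?_ (Real.sqrt_nonneg _)
  change √I.B + √(invQuad (I.σ ^ 2) (fun i => Z i ω) t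
    (noiseSum (fun i => Z i ω) (fun i => N i ω) t)) ≤ _
  rcases t with _ | j
  -- Without data there is no noise, and `√B` alone suffices.
  · have h1 : 0 ≤ Real.log (((0 + 1 : ℕ) : ℝ) / I.δ) :=
      Real.log_nonneg ((one_le_div hδ0).mpr (by simpa using hδ1.le))
    have h2 := gamma_nonneg I hfeat hσ (0 + 1)
    simp only [noiseSum, Finset.range_zero, Finset.sum_empty, invQuad, zero_dotProduct,
      Real.sqrt_zero, add_zero]
    refine Real.sqrt_le_sqrt ?_
    unfold Inputs.beta
    have : 0 ≤ 300 * I.gamma (0 + 1) * Real.log (((0 + 1 : ℕ) : ℝ) / I.δ) ^ 3 := by positivity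
    linarith
  · have hvol : logVol (I.σ ^ 2) (fun i => Z i ω) (j + 1) ≤ 2 * γ j :=
      (logVol_mono hlam _ (Nat.le_succ _)).trans
        (logVol_le_two_mul_gamma I hfeat hσ (fun t => x t ω) (j + 2))
    refine sqrt_add_sqrt_le_sqrt_beta hB (hγ j) hδ0 hδ1 j (invQuad_nonneg hlam _ _ _) ?_
    have hlogpos : 0 ≤ Real.log (1 / δ' j) := by
      refine Real.log_nonneg ((one_le_div (hδ' j)).mpr ?_)
      rw [div_le_one (by positivity)]
      have : (0 : ℝ) ≤ j := j.cast_nonneg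
      nlinarith
    rcases (hγ j).eq_or_lt with h | h
    · rw [noiseSum_eq_zero hlam _ _ _ (hvol.trans (by linarith)), invQuad, zero_dotProduct]
      exact mul_nonneg (by linarith [hγ j]) (by linarith [show 0 ≤ Real.log (1 / (I.δ / _)) from hlogpos])
    · have hnb : ¬ ω ∈ bad j := fun hb => hω (Set.mem_iUnion.mpr ⟨j, hb⟩)
      have h3 : invQuad (min 1 (4 * γ j) * I.σ ^ 2) (fun i => Z i ω) (j + 1)
          (noiseSum (fun i => Z i ω) (fun i => N i ω) (j + 1)) ≤
          logVol (min 1 (4 * γ j) * I.σ ^ 2) (fun i => Z i ω) (j + 1) +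
            2 * Real.log (1 / δ' j) := not_lt.mp fun hlt => hnb ⟨h, hlt⟩
      obtain ⟨h4, h5⟩ := invQuad_le_of_logVol_le hlam h (fun i => Z i ω) (j + 1) hvol
        (noiseSum (fun i => Z i ω) (fun i => N i ω) (j + 1))
      have hc : 0 < min 1 (4 * γ j) := by positivity
      have hc4 : min 1 (4 * γ j) ≤ 4 * γ j := min_le_right _ _
      calc _ ≤ _ := h4
        _ ≤ 2 * min 1 (4 * γ j) * (logVol (min 1 (4 * γ j) * I.σ ^ 2) (fun i => Z i ω) (j + 1) +
            2 * Real.log (1 / δ' j)) := by gcongr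
        _ = 2 * (min 1 (4 * γ j) * logVol (min 1 (4 * γ j) * I.σ ^ 2) (fun i => Z i ω) (j + 1)) +
            4 * (min 1 (4 * γ j) * Real.log (1 / δ' j)) := by ring
        _ ≤ 2 * (4 * γ j) + 4 * (4 * γ j * Real.log (1 / δ' j)) := by gcongr
        _ = _ := by ring

end Confidence

/-! ### Polylogarithmic growth of `β_t γ_t`. -/

section Growth

variable {ι : Type*} [Fintype ι] [DecidableEq ι]

/-- Every eigenvalue is at most the trace, so the determinant is at most a power of the trace. -/
lemma exp_logVol_le {lam : ℝ} (hlam : 0 < lam) (z : ℕ → ι → ℝ) (t : ℕ)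
    (hz : ∀ i, z i ⬝ᵥ z i ≤ 1) :
    Real.exp (logVol lam z t) ≤ (Fintype.card ι + t / lam) ^ Fintype.card ι := by
  have hV := regMat_posDef hlam z t
  have htr : (regMat lam z t).trace ≤ lam * (Fintype.card ι + t / lam) := by
    have h1 : (regMat lam z t).trace =
        lam * Fintype.card ι + ∑ i ∈ Finset.range t, z i ⬝ᵥ z i := by
      simp [regMat, Matrix.trace_sum, Matrix.trace_vecMulVec]
    have h2 : ∑ i ∈ Finset.range t, z i ⬝ᵥ z i ≤ t := by
      simpa using Finset.sum_le_card_nsmul (Finset.range t) _ 1 fun i _ => hz i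
    rw [h1, mul_add, mul_div_cancel₀ _ hlam.ne']
    linarith
  have hdet : (regMat lam z t).det ≤ (lam * (Fintype.card ι + t / lam)) ^ Fintype.card ι := by
    have hpos := fun i => (hV.eigenvalues_pos i).le
    rw [hV.isHermitian.trace_eq_sum_eigenvalues] at htr
    rw [hV.isHermitian.det_eq_prod_eigenvalues]
    refine (Finset.prod_le_prod (fun i _ => hpos i) fun i _ =>
      (Finset.single_le_sum (fun i _ => hpos i) (Finset.mem_univ i)).trans htr).trans_eq ?_
    rw [Finset.prod_const, Finset.card_univ]
  rw [det_regMat hlam, mul_pow] at hdet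
  exact le_of_mul_le_mul_left hdet (by positivity)

lemma gamma_le {S A : Type*} [Finite S] [Nonempty S] (I : Inputs S A)
    {feat : S → ι → ℝ} (hfeat : ∀ s s', I.k s s' = feat s ⬝ᵥ feat s') (hσ : 0 < I.σ)
    (hk1 : ∀ s, I.k s s ≤ 1) (t : ℕ) :
    I.gamma t ≤ Fintype.card ι * Real.log (Fintype.card ι + t / I.σ ^ 2) := by
  have hlam : 0 < I.σ ^ 2 := by positivity
  refine ciSup_le fun a => ?_
  obtain ⟨x, rfl⟩ := exists_eq_design a
  rw [infoGain_design_eq I hfeat hσ, ← Real.log_pow]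
  have h1 := exp_logVol_le hlam (fun i => feat (x (i + 1))) t fun i => by rw [← hfeat]; exact hk1 _
  have h2 := (Real.le_log_iff_exp_le ((Real.exp_pos _).trans_le h1)).mpr h1
  have h3 := logVol_nonneg hlam (fun i => feat (x (i + 1))) t
  linarith

/-- The product `β_t γ_t` grows sublinearly. -/
lemma exists_mul_beta_mul_gamma_le {S A : Type*} [Finite S] [Nonempty S] (I : Inputs S A)
    {feat : S → ι → ℝ} (hfeat : ∀ s s', I.k s s' = feat s ⬝ᵥ feat s') (hσ : 0 < I.σ)
    (hk1 : ∀ s, I.k s s ≤ 1) (hδ0 : 0 < I.δ) (hB : 0 ≤ I.B) {K : ℝ} (hK : 0 ≤ K) (n : ℕ) :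
    ∃ t : ℕ, n ≤ t ∧ K * (I.beta t * I.gamma t) ≤ t := by
  set d : ℝ := (Fintype.card ι : ℝ)
  have hd : 0 ≤ d := Nat.cast_nonneg _
  have hlam : 0 < I.σ ^ 2 := by positivity
  -- Chosen so that `a * t` dominates the arguments of both logarithms; the summand `3 > e` ensures
  -- `log (a * t) ≥ 1`.
  set a : ℝ := d + 1 / I.σ ^ 2 + 1 / I.δ + 3 with ha
  have ha0 : 0 < a := by positivity
  set K' : ℝ := K * ((2 * I.B + 300 * d) * d) with hK'
  have hK'0 : 0 ≤ K' := by positivity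
  have hlim : Filter.Tendsto (fun t : ℕ => a * (t : ℝ)) Filter.atTop Filter.atTop :=
    tendsto_natCast_atTop_atTop.const_mul_atTop ha0
  have hO := (Real.isLittleO_pow_log_id_atTop (n := 5)).comp_tendsto hlim
  have hc : 0 < 1 / (a * (K' + 1)) := by positivity
  obtain ⟨t, ⟨hnt, ht1⟩, ht⟩ := (((Filter.eventually_ge_atTop n).and
    (Filter.eventually_ge_atTop 1)).and (hO.def hc)).exists
  refine ⟨t, hnt, ?_⟩
  have ht1' : (1 : ℝ) ≤ t := by exact_mod_cast ht1
  set ℓ := Real.log (a * t) with hℓ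
  have hu : d + t / I.σ ^ 2 ≤ a * t := by
    have : d ≤ d * t := le_mul_of_one_le_right hd ht1'
    have h2 : 0 ≤ 1 / I.δ * t := by positivity
    rw [ha, add_mul, add_mul, add_mul, one_div_mul_eq_div]
    linarith
  have hv : t / I.δ ≤ a * t := by
    have h2 : 0 ≤ 1 / I.σ ^ 2 * t := by positivity
    have h3 : 0 ≤ d * t := by positivity
    rw [ha, add_mul, add_mul, add_mul, one_div_mul_eq_div I.δ]
    linarith
  have hℓ1 : 1 ≤ ℓ := by
    rw [hℓ, Real.le_log_iff_exp_le (by positivity)]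
    have h1 := Real.exp_one_lt_d9
    have h2 : 3 ≤ a := by
      have : 0 ≤ d + 1 / I.σ ^ 2 + 1 / I.δ := by positivity
      linarith
    nlinarith
  have h0 : 0 < d + t / I.σ ^ 2 := by positivity
  have hγ0 := gamma_nonneg I hfeat hσ t
  have hγ : I.gamma t ≤ d * ℓ := (gamma_le I hfeat hσ hk1 t).trans
    (mul_le_mul_of_nonneg_left (Real.log_le_log h0 hu) hd)
  have hβ : I.beta t ≤ (2 * I.B + 300 * d) * ℓ ^ 4 := by
    have h1 : Real.log (t / I.δ) ^ 3 ≤ ℓ ^ 3 :=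
      -- Odd powers are monotone on all of `ℝ`, so the sign of `log (t / δ)` does not matter.
      Odd.strictMono_pow (by decide) |>.monotone (Real.log_le_log (by positivity) hv)
    have h2 : 300 * I.gamma t * Real.log (t / I.δ) ^ 3 ≤ 300 * (d * ℓ) * ℓ ^ 3 :=
      (mul_le_mul_of_nonneg_left h1 (by positivity)).trans
        (mul_le_mul_of_nonneg_right (by linarith) (by positivity))
    have h3 : 2 * I.B ≤ 2 * I.B * ℓ ^ 4 := le_mul_of_one_le_right (by positivity)
      (one_le_pow₀ hℓ1)
    rw [Inputs.beta]
    calc _ ≤ 2 * I.B * ℓ ^ 4 + 300 * (d * ℓ) * ℓ ^ 3 := add_le_add h3 h2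
      _ = _ := by ring
  have hβγ : I.beta t * I.gamma t ≤ (2 * I.B + 300 * d) * ℓ ^ 4 * (d * ℓ) :=
    (mul_le_mul_of_nonneg_right hβ hγ0).trans (mul_le_mul_of_nonneg_left hγ (by positivity))
  have h5 : ℓ ^ 5 ≤ 1 / (a * (K' + 1)) * (a * t) := by
    have h6 : ‖ℓ ^ 5‖ ≤ 1 / (a * (K' + 1)) * ‖a * (t : ℝ)‖ := ht
    rwa [Real.norm_of_nonneg (by positivity), Real.norm_of_nonneg (by positivity)] at h6
  have h7 : 1 / (a * (K' + 1)) * (a * t) = t / (K' + 1) := by field_simp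
  rw [h7, le_div_iff₀ (by positivity)] at h5
  calc K * (I.beta t * I.gamma t) ≤ K * ((2 * I.B + 300 * d) * ℓ ^ 4 * (d * ℓ)) := by gcongr
    _ = K' * ℓ ^ 5 := by rw [hK']; ring
    _ ≤ ℓ ^ 5 * (K' + 1) := by nlinarith [show 0 ≤ ℓ ^ 5 by positivity]
    _ ≤ t := h5

end Growth

/-! ### Monotonicity of the set operators. -/

namespace MDP

variable {S A : Type*} (M : MDP S A)

lemma reach_mono : Monotone M.reach := by
  rintro X X' h s (hs | ⟨s', hs', a, ha, e⟩)
  · exact Or.inl (h hs)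
  · exact Or.inr ⟨s', h hs', a, ha, e⟩

lemma ret_mono {Y Y' X X' : Set S} (hY : Y ⊆ Y') (hX : X ⊆ X') : M.ret Y X ⊆ M.ret Y' X' := by
  rintro s (hs | ⟨hs, a, ha, e⟩)
  · exact Or.inl (hX hs)
  · exact Or.inr ⟨hY hs, a, ha, hX e⟩

lemma retBar_mono {Y Y' X X' : Set S} (hY : Y ⊆ Y') (hX : X ⊆ X') :
    M.retBar Y X ⊆ M.retBar Y' X' := by
  refine Set.iUnion_mono fun n => ?_
  induction n with
  | zero => exact hX
  | succ n ih =>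
    rw [Function.iterate_succ_apply', Function.iterate_succ_apply']
    exact M.ret_mono hY ih

lemma subset_retBar (Y X : Set S) : X ⊆ M.retBar Y X :=
  Set.subset_iUnion (fun n => (M.ret Y)^[n] X) 0

variable [MetricSpace S] (r : S → ℝ) (L : ℝ≥0) (h ε : ℝ)

lemma safeExt_mono : Monotone (M.safeExt r L h ε) := by
  rintro X X' hX s (hs | ⟨s', hs', e⟩)
  · exact Or.inl (hX hs)
  · exact Or.inr ⟨s', hX hs', e⟩

lemma expand_mono : Monotone (M.expand r L h ε) := fun _ _ hX =>
  Set.inter_subset_inter (Set.inter_subset_inter (M.safeExt_mono r L h ε hX) (M.reach_mono hX))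
    (M.retBar_mono (M.safeExt_mono r L h ε hX) hX)

lemma subset_expandBar (X : Set S) : X ⊆ M.expandBar r L h ε X :=
  Set.subset_iUnion (fun n => (M.expand r L h ε)^[n] X) 0

/-- A set that contains `X` and is not enlarged by `R_ε` contains `R̄_ε(X)`. -/
lemma expandBar_subset {X Y : Set S} (hX : X ⊆ Y) (hY : M.expand r L h ε Y ⊆ Y) :
    M.expandBar r L h ε X ⊆ Y := by
  refine Set.iUnion_subset fun n => ?_
  induction n with
  | zero => exact hX
  | succ n ih =>
    rw [Function.iterate_succ_apply']
    exact (M.expand_mono r L h ε ih).trans hY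

end MDP

/-! ### Deterministic analysis on the confidence event. -/

section Execution

variable {S A : Type*} [MetricSpace S] (I : Inputs S A) {r : S → ℝ} (hrL : LipschitzWith I.L r)
  (hS₀_safe : ∀ s ∈ I.S₀, I.h ≤ r s) {x : ℕ → S} {y : ℕ → ℝ}
  (hconf : ∀ t s, |r s - I.postMean x y t s| ≤ √(I.beta (t + 1)) * I.postStd x t s)

include hS₀_safe hconf in
lemma lower_le (t : ℕ) (s : S) : I.lower x y t s ≤ (r s : EReal) := by
  induction t with
  | zero =>
    rw [Inputs.lower]
    split_ifs with hs
    · exact EReal.coe_le_coe_iff.mpr (hS₀_safe s hs)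
    · exact bot_le
  | succ t ih =>
    rw [Inputs.lower]
    refine max_le ih (EReal.coe_le_coe_iff.mpr ?_)
    linarith [(abs_le.mp (hconf t s)).1]

include hconf in
lemma le_upper (t : ℕ) (s : S) : (r s : EReal) ≤ I.upper x y t s := by
  induction t with
  | zero => exact le_top
  | succ t ih =>
    rw [Inputs.upper]
    refine le_min ih (EReal.coe_le_coe_iff.mpr ?_)
    linarith [(abs_le.mp (hconf t s)).2]

include hS₀_safe hconf in
/-- The confidence intervals are bounded intervals around the true value. -/
lemma exists_lower_upper (t : ℕ) (s : S) : ∃ l u : ℝ, I.lower x y (t + 1) s = l ∧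
    I.upper x y (t + 1) s = u ∧ l ≤ r s ∧ r s ≤ u ∧
    u - l ≤ 2 * (√(I.beta (t + 1)) * I.postStd x t s) := by
  have hl := lower_le I hS₀_safe hconf (t + 1) s
  have hu := le_upper I hconf (t + 1) s
  have hl' : ((I.postMean x y t s - √(I.beta (t + 1)) * I.postStd x t s : ℝ) : EReal) ≤
      I.lower x y (t + 1) s := by rw [Inputs.lower]; exact le_max_right _ _
  have hu' : I.upper x y (t + 1) s ≤
      ((I.postMean x y t s + √(I.beta (t + 1)) * I.postStd x t s : ℝ) : EReal) := by
    rw [Inputs.upper]; exact min_le_right _ _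
  have e1 := EReal.coe_toReal (ne_top_of_le_ne_top (EReal.coe_ne_top _) hl)
    (ne_bot_of_le_ne_bot (EReal.coe_ne_bot _) hl')
  have e2 := EReal.coe_toReal (ne_top_of_le_ne_top (EReal.coe_ne_top _) hu')
    (ne_bot_of_le_ne_bot (EReal.coe_ne_bot _) hu)
  refine ⟨_, _, e1.symm, e2.symm, ?_⟩
  rw [← e1, EReal.coe_le_coe_iff] at hl hl'
  rw [← e2, EReal.coe_le_coe_iff] at hu hu'
  exact ⟨hl, hu, by linarith⟩

lemma lower_mono (s : S) : Monotone fun t => I.lower x y t s :=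
  monotone_nat_of_le_succ fun t => by
    rw [Inputs.lower]
    exact le_max_left _ _

include hS₀_safe hconf in
lemma le_of_certified {t : ℕ} {s s' : S}
    (h : (I.h : EReal) ≤ I.lower x y t s' - ((I.L * dist s s' : ℝ) : EReal)) :
    I.h ≤ r s' - I.L * dist s s' := by
  have h1 := h.trans (EReal.sub_le_sub (lower_le I hS₀_safe hconf t s') le_rfl)
  rwa [← EReal.coe_sub, EReal.coe_le_coe_iff] at h1

include hS₀_safe hconf in
lemma certified_subset_safeExt (t : ℕ) (X : Set S) :
    I.certified x y t X ⊆ I.mdp.safeExt r I.L I.h 0 X := by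
  rintro s ⟨s', hs', h⟩
  refine Or.inr ⟨s', hs', ?_⟩
  rw [sub_zero]
  exact le_of_certified I hS₀_safe hconf h

include hrL hS₀_safe hconf in
lemma le_of_mem_certified {t : ℕ} {X : Set S} {s : S} (hs : s ∈ I.certified x y t X) :
    I.h ≤ r s := by
  obtain ⟨s', -, h⟩ := hs
  have h1 := le_of_certified I hS₀_safe hconf h
  have h2 := hrL.dist_le_mul s' s
  rw [Real.dist_eq, dist_comm] at h2
  linarith [le_abs_self (r s' - r s)]

lemma certified_mono {t t' : ℕ} (ht : t ≤ t') {X X' : Set S} (hX : X ⊆ X') :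
    I.certified x y t X ⊆ I.certified x y t' X' := by
  rintro s ⟨s', hs', h⟩
  exact ⟨s', hX hs', h.trans (EReal.sub_le_sub (lower_mono I s' ht) le_rfl)⟩

lemma hatS_succ_subset_certified (t : ℕ) :
    I.hatS x y (t + 1) ⊆ I.certified x y (t + 1) (I.hatS x y t) := fun _ hs => hs.1

/-- The inductive step of `hatS_subset_succ`. -/
lemma hatS_subset_succ_of_certified {t : ℕ}
    (h : I.hatS x y t ⊆ I.certified x y (t + 1) (I.hatS x y t)) :
    I.hatS x y t ⊆ I.hatS x y (t + 1) := fun _ hs =>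
  ⟨h hs, Or.inl hs, I.mdp.subset_retBar _ _ hs⟩

lemma hatS_subset_certified (t : ℕ) : I.hatS x y t ⊆ I.certified x y (t + 1) (I.hatS x y t) := by
  induction t with
  | zero =>
    intro s hs
    refine ⟨s, hs, ?_⟩
    -- The initial intervals `[h, ∞)` on the seed let each seed state certify itself at distance
    -- zero.
    have h0 : (I.h : EReal) ≤ I.lower x y 0 s := by
      rw [Inputs.lower, if_pos (show s ∈ I.S₀ from hs)]
    simpa using h0.trans (lower_mono I s zero_le_one)
  | succ t ih =>
    exact (hatS_succ_subset_certified I t).trans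
      (certified_mono I (Nat.le_succ _) (hatS_subset_succ_of_certified I ih))

lemma hatS_mono : Monotone (I.hatS x y) :=
  monotone_nat_of_le_succ fun t => hatS_subset_succ_of_certified I (hatS_subset_certified I t)

include hS₀_safe hconf in
lemma hatS_subset_expandBar (t : ℕ) : I.hatS x y t ⊆ I.mdp.expandBar r I.L I.h 0 I.S₀ := by
  have h : I.hatS x y t ⊆ (I.mdp.expand r I.L I.h 0)^[t] I.S₀ := by
    induction t with
    | zero => exact subset_rfl
    | succ t ih =>
      rw [Function.iterate_succ_apply']
      refine subset_trans ?_ (I.mdp.expand_mono r I.L I.h 0 ih)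
      rintro s ⟨h1, h2, h3⟩
      have hc := certified_subset_safeExt I hS₀_safe hconf (t + 1) (I.hatS x y t)
      exact ⟨⟨hc h1, h2⟩, I.mdp.retBar_mono hc subset_rfl h3⟩
  exact h.trans (Set.subset_iUnion (fun n => (I.mdp.expand r I.L I.h 0)^[n] I.S₀) t)

variable {τ : ℕ → ℕ} {path : ℕ → S} (hexec : I.IsExecution x y τ path)

include hrL hS₀_safe hconf hexec in
/-- The trajectory is safe when the confidence intervals are correct. -/
lemma le_path (n : ℕ) : I.h ≤ r (path n) := by
  -- The least such `t` identifies the iteration `t + 1` during which time `n` occurs.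
  have hex : ∃ t, n ≤ τ (t + 1) := ⟨n, (Nat.le_succ n).trans (hexec.time_strictMono.le_apply)⟩
  classical
  have h1 := Nat.find_spec hex
  have h2 : τ (Nat.find hex) ≤ n := by
    rcases h : Nat.find hex with _ | t
    · rw [hexec.time_zero]; exact Nat.zero_le _
    · have := Nat.find_min hex (m := t) (by omega)
      omega
  exact le_of_mem_certified I hrL hS₀_safe hconf (hexec.travel _ n h2 h1)

include hS₀_safe hconf hexec in
/-- As long as there is something to gain but no progress, the measured state is uncertain. -/
lemma lt_postStd_of_hatS_eq [Finite S] {ε : ℝ} (hε : 0 < ε) {t : ℕ}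
    (hT : I.hatS x y (t + 1) = I.hatS x y t)
    (hR : ¬ I.mdp.expand r I.L I.h ε (I.hatS x y t) ⊆ I.hatS x y t) :
    ε < 2 * (√(I.beta (t + 1)) * I.postStd x t (x (t + 1))) := by
  -- Reachability and returnability agree in `R_ε` and in the algorithm, so lack of progress can
  -- only come from an uncertified state. Some `s'` would certify it with margin `ε`. Hence `s'` is
  -- an expander of width above `ε`, and the target is at least as wide.
  have h1 : ¬ I.mdp.safeExt r I.L I.h ε (I.hatS x y t) ⊆
      I.certified x y (t + 1) (I.hatS x y t) := by
    intro h
    refine hR fun s hs => ?_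
    rw [← hT]
    exact ⟨h hs.1.1, hs.1.2, I.mdp.retBar_mono h subset_rfl hs.2⟩
  obtain ⟨s, hs, hsn⟩ := Set.not_subset.mp h1
  rcases hs with hs | ⟨s', hs', hle⟩
  · exact absurd (hatS_subset_certified I t hs) hsn
  obtain ⟨l, u, el, eu, hl, hu, -⟩ := exists_lower_upper I hS₀_safe hconf t s'
  obtain ⟨l', u', el', eu', -, -, hw'⟩ := exists_lower_upper I hS₀_safe hconf t (x (t + 1))
  have hexp : s' ∈ I.expanders x y (t + 1) := by
    refine ⟨hT ▸ hs', (Set.ncard_pos (Set.toFinite _)).mpr ⟨s, hsn, ?_⟩⟩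
    rw [eu, ← EReal.coe_sub, EReal.coe_le_coe_iff, dist_comm]
    linarith
  have hlow : l - I.L * dist s s' < I.h := by
    by_contra! hcon
    refine hsn ⟨s', hs', ?_⟩
    rwa [el, ← EReal.coe_sub, EReal.coe_le_coe_iff]
  have hmax := (hexec.target_argmax (t + 1) (by omega) ⟨s', hexp⟩).2 s' hexp
  rw [Inputs.width, Inputs.width, el, eu, el', eu', ← EReal.coe_sub, ← EReal.coe_sub,
    EReal.coe_le_coe_iff] at hmax
  linarith

/-- In all but few of the first `t` iterations the set `Ŝ` does not change. -/
lemma add_one_le_card_filter_add_ncard [Finite S] (hS₀ : I.S₀.Nonempty) (t : ℕ)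
    [DecidablePred fun i => I.hatS x y (i + 1) = I.hatS x y i] :
    t + 1 ≤ ((Finset.range t).filter fun i => I.hatS x y (i + 1) = I.hatS x y i).card +
      (I.hatS x y t).ncard := by
  induction t with
  | zero =>
    have : 0 < (I.hatS x y 0).ncard := (Set.ncard_pos (Set.toFinite _)).mpr hS₀
    omega
  | succ t ih =>
    have hsub := hatS_mono I (x := x) (y := y) t.le_succ
    rw [Finset.range_add_one, Finset.filter_insert]
    split_ifs with h
    · rw [Finset.card_insert_of_notMem (by simp), h]
      omega
    · have := Set.ncard_lt_ncard (hsub.ssubset_of_ne (Ne.symm h)) (Set.toFinite _)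
      rw [Nat.succ_eq_add_one] at this
      omega

end Execution

/-! ### Sample complexity of the exploration. -/

section SampleComplexity

/-- By concavity, `log (1 + ·)` lies above its chord on `[0, b]`. With `b = σ⁻²` this compares
variances with information gain. -/
lemma mul_log_one_add_le {v b : ℝ} (hb : 0 < b) (hv : 0 ≤ v) (hvb : v ≤ b) :
    v * Real.log (1 + b) ≤ b * Real.log (1 + v) := by
  have h := strictConcaveOn_log_Ioi.concaveOn.2 (show (1 : ℝ) ∈ Set.Ioi 0 by simp)
    (show 1 + b ∈ Set.Ioi (0 : ℝ) by simp; linarith)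
    (show 0 ≤ 1 - v / b by rw [sub_nonneg, div_le_one hb]; exact hvb)
    (show 0 ≤ v / b by positivity) (by ring)
  simp only [smul_eq_mul, Real.log_one, mul_zero, zero_add] at h
  have e : (1 - v / b) * 1 + v / b * (1 + b) = 1 + v := by field_simp; ring
  rw [e] at h
  have := mul_le_mul_of_nonneg_left h hb.le
  rwa [← mul_assoc, mul_div_cancel₀ _ hb.ne'] at this

variable {S A ι : Type*} [Finite S] [Nonempty S] [Fintype ι] [DecidableEq ι] (I : Inputs S A)
  {feat : S → ι → ℝ} (hfeat : ∀ s s', I.k s s' = feat s ⬝ᵥ feat s') (hσ : 0 < I.σ)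
  (hk1 : ∀ s, I.k s s ≤ 1)

include hfeat hσ hk1 in
/-- The posterior variances of the measured states are controlled by the information gain. -/
lemma sum_postStd_sq_le (x : ℕ → S) (t : ℕ) :
    ∑ i ∈ Finset.range t, I.postStd x i (x (i + 1)) ^ 2 ≤
      2 / Real.log (1 + (I.σ ^ 2)⁻¹) * I.gamma t := by
  have hlam : 0 < I.σ ^ 2 := by positivity
  have hlog : 0 < Real.log (1 + (I.σ ^ 2)⁻¹) := Real.log_pos (by
    have : 0 < (I.σ ^ 2)⁻¹ := by positivity
    linarith)
  have hvol := logVol_le_two_mul_gamma I hfeat hσ x t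
  have h : ∑ i ∈ Finset.range t, I.postStd x i (x (i + 1)) ^ 2 ≤
      (Real.log (1 + (I.σ ^ 2)⁻¹))⁻¹ * logVol (I.σ ^ 2) (fun i => feat (x (i + 1))) t := by
    rw [logVol, Finset.mul_sum]
    refine Finset.sum_le_sum fun i _ => ?_
    have h0 := invQuad_nonneg hlam (fun i => feat (x (i + 1))) i (feat (x (i + 1)))
    have h1 := (mul_invQuad_le hlam (fun i => feat (x (i + 1))) i (feat (x (i + 1)))).trans
      ((hfeat _ _).symm.trans_le (hk1 (x (i + 1))))
    rw [postStd_eq I hfeat hσ, Real.sq_sqrt (by positivity)]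
    have h2 := mul_log_one_add_le (inv_pos.mpr hlam) h0 ((le_inv_mul_iff₀ hlam).mpr h1 |>.trans_eq
      (mul_one _))
    rw [le_inv_mul_iff₀ hlog]
    calc _ = I.σ ^ 2 * (invQuad (I.σ ^ 2) (fun i => feat (x (i + 1))) i (feat (x (i + 1))) *
          Real.log (1 + (I.σ ^ 2)⁻¹)) := by ring
      _ ≤ I.σ ^ 2 * ((I.σ ^ 2)⁻¹ * _) := by gcongr
      _ = _ := by rw [mul_inv_cancel_left₀ hlam.ne']
  refine h.trans ?_
  rw [div_mul_eq_mul_div, ← div_eq_inv_mul]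
  gcongr

include hfeat hσ hk1 in
/-- The exploration is complete after the time given by the sample complexity bound. -/
theorem expandBar_subset_hatS [MetricSpace S] (hδ0 : 0 < I.δ) (hδ1 : I.δ < 1) (hB : 0 ≤ I.B)
    {r : S → ℝ} {ε : ℝ} (hε : 0 < ε)
    (hS₀ : I.S₀.Nonempty) (hS₀_safe : ∀ s ∈ I.S₀, I.h ≤ r s) {x : ℕ → S} {y : ℕ → ℝ}
    (hconf : ∀ t s, |r s - I.postMean x y t s| ≤ √(I.beta (t + 1)) * I.postStd x t s)
    {τ : ℕ → ℕ} {path : ℕ → S} (hexec : I.IsExecution x y τ path) {T : ℕ}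
    (hT1 : (I.mdp.expandBar r I.L I.h 0 I.S₀).ncard ≤ T)
    (hT2 : (8 / Real.log (1 + (I.σ ^ 2)⁻¹)) * (I.mdp.expandBar r I.L I.h 0 I.S₀).ncard / ε ^ 2 *
      (I.beta T * I.gamma T) ≤ T) :
    I.mdp.expandBar r I.L I.h ε I.S₀ ⊆ I.hatS x y T := by
  classical
  by_contra hcon
  -- Were some `Ŝ_t` with `t ≤ T` closed under `R_ε`, it would contain `R̄_ε(S₀)`, and so would
  -- `Ŝ_T`.
  have hR : ∀ t ≤ T, ¬ I.mdp.expand r I.L I.h ε (I.hatS x y t) ⊆ I.hatS x y t := fun t ht h =>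
    hcon ((I.mdp.expandBar_subset r I.L I.h ε (hatS_mono I (Nat.zero_le t)) h).trans
      (hatS_mono I ht))
  set N := (I.mdp.expandBar r I.L I.h 0 I.S₀).ncard
  set good := (Finset.range T).filter fun i => I.hatS x y (i + 1) = I.hatS x y i with hgood
  have hcard : T + 1 ≤ good.card + N := by
    have h1 : T + 1 ≤ good.card + (I.hatS x y T).ncard := by
      convert add_one_le_card_filter_add_ncard I (x := x) (y := y) hS₀ T
    have h2 : (I.hatS x y T).ncard ≤ N :=
      Set.ncard_le_ncard (hatS_subset_expandBar I hS₀_safe hconf T) (Set.toFinite _)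
    omega
  have hγ := gamma_nonneg I hfeat hσ T
  have hβT : 0 ≤ I.beta T := by
    have h1 : 0 ≤ Real.log (T / I.δ) := by
      rcases T.eq_zero_or_pos with h | h
      -- Here `Real.log 0 = 0`.
      · simp [h]
      · have : (1 : ℝ) ≤ T := by exact_mod_cast h
        exact Real.log_nonneg ((one_le_div hδ0).mpr (by linarith))
    unfold Inputs.beta
    positivity
  have hstep : ∀ i ∈ good, ε ^ 2 < 4 * I.beta T * I.postStd x i (x (i + 1)) ^ 2 := by
    intro i hi
    obtain ⟨hiT, hieq⟩ := Finset.mem_filter.mp hi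
    have hiT' := Finset.mem_range.mp hiT
    have h1 := lt_postStd_of_hatS_eq I hS₀_safe hconf hexec hε hieq (hR i hiT'.le)
    have h2 : √(I.beta (i + 1)) ≤ √(I.beta T) :=
      Real.sqrt_le_sqrt (beta_mono I hfeat hσ hδ0 hδ1 (by omega) hiT')
    have h3 : 0 ≤ I.postStd x i (x (i + 1)) := Real.sqrt_nonneg _
    have h4 : ε < 2 * (√(I.beta T) * I.postStd x i (x (i + 1))) := h1.trans_le (by gcongr)
    calc ε ^ 2 < (2 * (√(I.beta T) * I.postStd x i (x (i + 1)))) ^ 2 := by gcongr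
      _ = 4 * √(I.beta T) ^ 2 * I.postStd x i (x (i + 1)) ^ 2 := by ring
      _ = _ := by rw [Real.sq_sqrt hβT]
  have hgoodpos : good.Nonempty := by
    rw [← Finset.card_pos]
    omega
  have hsum : good.card * ε ^ 2 < 8 / Real.log (1 + (I.σ ^ 2)⁻¹) * (I.beta T * I.gamma T) := by
    calc (good.card : ℝ) * ε ^ 2 = ∑ i ∈ good, ε ^ 2 := by simp
      _ < ∑ i ∈ good, 4 * I.beta T * I.postStd x i (x (i + 1)) ^ 2 :=
        Finset.sum_lt_sum_of_nonempty hgoodpos hstep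
      _ ≤ ∑ i ∈ Finset.range T, 4 * I.beta T * I.postStd x i (x (i + 1)) ^ 2 :=
        Finset.sum_le_sum_of_subset_of_nonneg (Finset.filter_subset _ _)
          fun i _ _ => by positivity
      _ = 4 * I.beta T * ∑ i ∈ Finset.range T, I.postStd x i (x (i + 1)) ^ 2 := by
        rw [Finset.mul_sum]
      _ ≤ 4 * I.beta T * (2 / Real.log (1 + (I.σ ^ 2)⁻¹) * I.gamma T) := by
        gcongr
        exact sum_postStd_sq_le I hfeat hσ hk1 x T
      _ = _ := by ring
  have hN : 1 ≤ N := (Set.ncard_pos (Set.toFinite _)).mpr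
    (hS₀.mono (I.mdp.subset_expandBar r I.L I.h 0 I.S₀))
  -- From `T + 1 ≤ good.card + N`, since a sum of two positive integers is at most one more than
  -- their product.
  have hTN : T ≤ N * good.card := by
    obtain ⟨n, hn⟩ := Nat.exists_eq_add_of_le hN
    obtain ⟨g, hg⟩ := Nat.exists_eq_add_of_le hgoodpos.card_pos
    nlinarith
  have hTN' : (T : ℝ) ≤ N * good.card := by exact_mod_cast hTN
  have hN' : (0 : ℝ) < N := by exact_mod_cast hN
  rw [mul_div_right_comm, mul_assoc, mul_comm (N : ℝ), ← mul_assoc, div_mul_eq_mul_div,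
    div_mul_eq_mul_div, div_le_iff₀ (by positivity)] at hT2
  nlinarith [mul_lt_mul_of_pos_right hsum hN',
    mul_le_mul_of_nonneg_right hTN' (sq_nonneg ε)]

end SampleComplexity

end

end SafeMDP

/-! ### The main theorem. -/

theorem mainTheorem1 {S A Ω H : Type*} [Fintype S] [MetricSpace S]
    [NormedAddCommGroup H] [InnerProductSpace ℝ H] [CompleteSpace H] [RKHS ℝ H S ℝ]
    [mΩ : MeasurableSpace Ω] (P : Measure Ω) [IsProbabilityMeasure P]
    (I : SafeMDP.Inputs S A) (r : S → ℝ) (ε : ℝ)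
    -- numerical parameters
    (hε : 0 < ε) (hσ : 0 < I.σ) (hδ0 : 0 < I.δ) (hδ1 : I.δ < 1)
    -- `H` is the RKHS of the kernel `k`, which is normalized, and `r` has squared norm at most `B`
    (hk : ∀ s s', RKHS.kernel H s s' 1 = I.k s s') (hk1 : ∀ s, I.k s s ≤ 1)
    (hrB : ∃ g : H, ⇑g = r ∧ ‖g‖ ^ 2 ≤ I.B)
    (hrL : LipschitzWith I.L r)
    -- the safe seed
    (hS₀ : I.S₀.Nonempty) (hS₀_safe : ∀ s ∈ I.S₀, I.h ≤ r s)
    (hS₀_ret : ∀ s ∈ I.S₀, ∀ s' ∈ I.S₀, s' ∈ I.mdp.retBar I.S₀ {s})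
    -- the noise is bounded by `σ` and has mean zero conditioned on the history `ℱ`
    (ℱ : Filtration ℕ mΩ) (noise : ℕ → Ω → ℝ)
    (hnoise_meas : ∀ t, StronglyMeasurable[ℱ (t + 1)] (noise (t + 1)))
    (hnoise_mean : ∀ t, P[noise (t + 1) | ℱ t] =ᵐ[P] 0)
    (hnoise_bdd : ∀ t, ∀ᵐ ω ∂P, |noise (t + 1) ω| ≤ I.σ)
    -- a random execution of the algorithm whose measured states are determined by the history
    (x : ℕ → Ω → S) (τ : ℕ → Ω → ℕ) (path : ℕ → Ω → S)
    (hx_meas : ∀ t s, MeasurableSet[ℱ t] {ω | x (t + 1) ω = s})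
    (hexec : ∀ ω, I.IsExecution (fun t => x t ω) (fun t => r (x t ω) + noise t ω)
      (fun t => τ t ω) (fun n => path n ω)) :
    SafeMDP.HoldsWithProb P (1 - I.δ) (fun ω => ∀ n, I.h ≤ r (path n ω)) ∧
    ∃ tstar : ℕ,
      IsLeast {t : ℕ | (I.mdp.expandBar r I.L I.h 0 I.S₀).ncard ≤ t ∧
        (8 / Real.log (1 + (I.σ ^ 2)⁻¹)) * (I.mdp.expandBar r I.L I.h 0 I.S₀).ncard / ε ^ 2 *
          (I.beta t * I.gamma t) ≤ t} tstar ∧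
      ∃ t₀ ≤ tstar, SafeMDP.HoldsWithProb P (1 - I.δ) (fun ω =>
        I.mdp.expandBar r I.L I.h ε I.S₀ ⊆
            I.hatS (fun t => x t ω) (fun t => r (x t ω) + noise t ω) t₀ ∧
          I.hatS (fun t => x t ω) (fun t => r (x t ω) + noise t ω) t₀ ⊆
            I.mdp.expandBar r I.L I.h 0 I.S₀) := by
  obtain ⟨g, hg, hgB⟩ := hrB
  obtain ⟨d, feat, θ, hfeat, hθ, hθB⟩ := SafeMDP.exists_features I.k hk g
  rw [hg] at hθ
  have hθB' := hθB.trans hgB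
  have hB : 0 ≤ I.B := (sq_nonneg _).trans hgB
  have : Nonempty S := hS₀.to_type
  have hconf := SafeMDP.holdsWithProb_confidence P I r hσ hδ0 hδ1 hfeat hθ hθB' ℱ noise
    hnoise_meas hnoise_mean hnoise_bdd x hx_meas
  refine ⟨hconf.mono fun ω hω n => SafeMDP.le_path I hrL hS₀_safe hω (hexec ω) n, ?_⟩
  have hlog : 0 < Real.log (1 + (I.σ ^ 2)⁻¹) := Real.log_pos (by
    have : 0 < (I.σ ^ 2)⁻¹ := by positivity
    linarith)
  have hex := SafeMDP.exists_mul_beta_mul_gamma_le I hfeat hσ hk1 hδ0 hB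
    (K := (8 / Real.log (1 + (I.σ ^ 2)⁻¹)) *
      (I.mdp.expandBar r I.L I.h 0 I.S₀).ncard / ε ^ 2) (by positivity)
    (I.mdp.expandBar r I.L I.h 0 I.S₀).ncard
  classical
  have hspec := Nat.find_spec hex
  -- The deterministic time `t₀` is `t*` itself.
  exact ⟨Nat.find hex, ⟨hspec, fun t ht => Nat.find_min' hex ht⟩, Nat.find hex, le_rfl,
    hconf.mono fun ω hω => ⟨SafeMDP.expandBar_subset_hatS I hfeat hσ hk1 hδ0 hδ1 hB hε hS₀ hS₀_safe
      hω (hexec ω) hspec.1 hspec.2, SafeMDP.hatS_subset_expandBar I hS₀_safe hω _⟩⟩
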